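/- For $\gamma>1$, $d>0$, $\alpha>0$ put $\theta_\gamma=\operatorname{artanh}(1/\gamma^{1/2})$ (the unique solution of $\cosh\theta-\gamma^{1/2}\sinh\theta=0$), $\Omega_\gamma=\{(\theta,W)\in\mathbb R^2 : \theta>0,\ (\theta,W)\neq(\theta_\gamma,0)\}$, $Q(\theta,W)=\frac d\gamma(\cosh\theta-\gamma^{1/2}\sinh\theta)^2+W^2$, and consider in $\Omega_\gamma$ the system $$\dot\theta=-\frac{\alpha\gamma^{1/2}W}{Q(\theta,W)^{3/2}},\qquad \dot W=-\frac1{d^{1/2}}\Big(\frac{\gamma^{3/2}}{\cosh\theta}+\frac1{\sinh\theta}\Big)+\frac{\alpha d(\sinh\theta-\gamma^{1/2}\cosh\theta)(\cosh\theta-\gamma^{1/2}\sinh\theta)}{\gamma^{1/2}Q(\theta,W)^{3/2}},\qquad(\ast)$$ which is Hamiltonian with $$\mathcal G(\theta,W)=\frac1{d^{1/2}}\Big(2\gamma^{3/2}\arctan\big(\tanh(\theta/2)\big)+\log\big(\tanh(\theta/2)\big)\Big)+\frac{\alpha\gamma^{1/2}}{Q(\theta,W)^{1/2}}.$$ A time-global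 solution of $(\ast)$ is called a leapfrogging solution if its solution curve is a closed orbit revolving around the point $(\theta_\gamma,0)$, i.e. it is periodic with nonzero winding number around $(\theta_\gamma,0)$. Theorem. Let $0<\alpha<1/3$. There exists $\gamma_*\in(1,\infty)$ such that for every $d>0$ the following holds. (a) If $1<\gamma\le\gamma_*$, then $(\ast)$ has no equilibria in $\Omega_\gamma$, and for every $(\theta_0,W_0)\in\Omega_\gamma$ the solution starting from $(\theta_0,W_0)$ is a leapfrogging solution if and only if $\mathcal G(\theta_0,W_0)>\dfrac{\pi\gamma^{3/2}}{2d^{1/2}}$. (b) If $\gamma>\gamma_*$, then $(\ast)$ has exactly one equilibrium in $\Omega_\gamma$; it is of the form $(\theta_*,0)$ with $\theta_*\in(\theta_\gamma,\infty)$. There is a unique $\overline\theta\in(0,\theta_\gamma)$ with $\mathcal G(\overline\theta,0)=\mathcal G(\theta_*,0)$, and for every $(\theta_0,W_0)\in\Omega_\gamma$ the solution starting from $(\theta_0,W_0)$ is a leapfrogging solution if and only if $\theta_0\in(\overline\theta,\theta_*)$ and $\mathcal G(\theta_0,W_0)>\mathcal G(\theta_*,0)$. -/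

import Mathlib

namespace OppositeFilaments

/-- The angle-like coordinate `θ_γ = artanh (1 / √γ)` at which the two circles have equal radii. -/
noncomputable def thetaOverlap (γ : ℝ) : ℝ := Real.artanh (1 / √γ)

/-- For `γ > 1`, `θ_γ` is positive and solves `cosh θ - √γ sinh θ = 0`. -/
theorem thetaOverlap_spec {γ : ℝ} (hγ : 1 < γ) :
    0 < thetaOverlap γ ∧
      Real.cosh (thetaOverlap γ) - √γ * Real.sinh (thetaOverlap γ) = 0 := by
  have hs : 1 < √γ := by
    rw [Real.lt_sqrt (by norm_num)]; linarith
  have h0 : 0 < 1 / √γ := by positivity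
  have h1 : 1 / √γ < 1 := by rw [div_lt_one (by linarith)]; exact hs
  refine ⟨Real.artanh_pos ⟨h0, h1⟩, ?_⟩
  have ht : Real.tanh (thetaOverlap γ) = 1 / √γ :=
    Real.tanh_artanh ⟨by linarith, h1⟩
  rw [Real.tanh_eq_sinh_div_cosh,
    div_eq_div_iff (Real.cosh_pos _).ne' (by linarith : √γ ≠ 0)] at ht
  linarith

/-- The phase space `Ω_γ`: the half plane `θ > 0` without the overlap point `(θ_γ, 0)`. -/
def phaseSpace (γ : ℝ) : Set (ℝ × ℝ) := {p | 0 < p.1 ∧ p ≠ (thetaOverlap γ, 0)}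

/-- The squared distance `(d / γ) (cosh θ - √γ sinh θ)² + W²` between the two circles in a
half plane bounded by the axis of symmetry. -/
noncomputable def sqDist (γ d θ W : ℝ) : ℝ :=
  d / γ * (Real.cosh θ - √γ * Real.sinh θ) ^ 2 + W ^ 2

/-- The right-hand side of the equation for `θ`. -/
noncomputable def fieldTheta (α γ d θ W : ℝ) : ℝ :=
  -(α * √γ * W / sqDist γ d θ W ^ (3 / 2 : ℝ))

/-- The right-hand side of the equation for `W`. -/
noncomputable def fieldW (α γ d θ W : ℝ) : ℝ :=
  -(1 / √d) * (γ ^ (3 / 2 : ℝ) / Real.cosh θ + 1 / Real.sinh θ) +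
    α * d * (Real.sinh θ - √γ * Real.cosh θ) * (Real.cosh θ - √γ * Real.sinh θ) /
      (√γ * sqDist γ d θ W ^ (3 / 2 : ℝ))

/-- The Hamiltonian `𝒢`. -/
noncomputable def hamiltonian (α γ d θ W : ℝ) : ℝ :=
  1 / √d * (2 * γ ^ (3 / 2 : ℝ) * Real.arctan (Real.tanh (θ / 2)) +
      Real.log (Real.tanh (θ / 2))) +
    α * √γ / √(sqDist γ d θ W)

/-- `p` is an equilibrium of the system in its phase space. -/
def IsEquilibrium (α γ d : ℝ) (p : ℝ × ℝ) : Prop :=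
  p ∈ phaseSpace γ ∧ fieldTheta α γ d p.1 p.2 = 0 ∧ fieldW α γ d p.1 p.2 = 0

/-- `(θ, W)` is a time-global solution of the system, with values in the phase space.
(Both components are then automatically `C¹`.) -/
structure IsSolution (α γ d : ℝ) (θ W : ℝ → ℝ) : Prop where
  mem : ∀ t, (θ t, W t) ∈ phaseSpace γ
  deriv_theta : ∀ t, HasDerivAt θ (fieldTheta α γ d (θ t) (W t)) t
  deriv_W : ∀ t, HasDerivAt W (fieldW α γ d (θ t) (W t)) t

/-- The plane curve `(x, y)`, closed with period `T`, revolves around `(a, b)`: it avoids `(a, b)`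
and its winding number around it over `[0, T]` is nonzero, i.e. a continuous choice `φ` of the
polar angle around `(a, b)` has a nonzero total increment over `[0, T]`. -/
def RevolvesAround (x y : ℝ → ℝ) (T a b : ℝ) : Prop :=
  ∃ r φ : ℝ → ℝ, Continuous φ ∧
    (∀ t, 0 < r t ∧ x t = a + r t * Real.cos (φ t) ∧ y t = b + r t * Real.sin (φ t)) ∧
    φ T ≠ φ 0

/-- The curve `(θ, W)` is a closed orbit (it is periodic, and not constant because it revolves)
revolving around the overlap point `(θ_γ, 0)`. -/
def IsLeapfrogging (γ : ℝ) (θ W : ℝ → ℝ) : Prop :=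
  ∃ T : ℝ, 0 < T ∧ Function.Periodic θ T ∧ Function.Periodic W T ∧
    RevolvesAround θ W T (thetaOverlap γ) 0

/-- The solution starting from `(θ₀, W₀)` is a leapfrogging solution. -/
def Leapfrogs (α γ d θ₀ W₀ : ℝ) : Prop :=
  ∃ θ W : ℝ → ℝ, IsSolution α γ d θ W ∧ θ 0 = θ₀ ∧ W 0 = W₀ ∧ IsLeapfrogging γ θ W

end OppositeFilaments

/-!
Write `g = √γ` and `s = √d`. On the axis `W = 0` the Hamiltonian is
`axisEnergy θ = F θ + α g² / (s |cosh θ - g sinh θ|)`, where the potential `F` increases from `-∞`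
to the limit `π g³ / (2 s)`. The axis energy increases from `-∞` to `+∞` on `(0, θ_γ)`. Beyond the
overlap the sign of its slope is that of `criticalRatio g (tanh θ) - α g²`, and `criticalRatio g`
increases from `0` to `(g³ + 1)(g - 1)` on `[1 / g, 1]`. So there is a critical point `θ_*` exactly when
`(g³ + 1)(g - 1) / g² > α`, it is then unique and a minimum beyond the overlap, and since the
left-hand side increases with `g`, this defines the threshold `γ_*`, independently of `d`.

*Sufficiency* (`leapfrogs_of_axisEnergy_lt`). Let `b` lie beyond the overlap, with nonpositive slope
of the axis energy at `b`, and let `E > axisEnergy b`. On the level `E` the distance `√Q` is the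
function `R = α g / (E - F)` of `θ`, so that `-(s / g) (cosh θ - g sinh θ) = R cos χ` and
`W = R sin χ` for a phase `χ`. Here `cos χ = v(θ)`, and `v` is increasing on `(0, b]`
(`levelCosDeriv_pos`): beyond the overlap this says that `turningEnergy θ < E`, and `turningEnergy`
is increasing and at `b` at most `axisEnergy b`. Hence the level curve in the strip `θ < b` is a
closed curve parametrized by `χ`, on which the system reads `χ' = α g v' / R²`. This scalar equation
with a positive periodic right-hand side is solved by quadrature (`exists_phase`), and the polar
angle around the overlap point follows `χ` up to a bounded error
(`revolvesAround_of_stretched_angle`). With an equilibrium one takes `b = θ_*`, otherwise any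
large `b`.

*Necessity.* A curve that revolves around a point meets every ray issuing from it
(`exists_mem_ray_of_revolvesAround`). So the conserved energy of a leapfrogging solution is
`axisEnergy θ` for some `θ > θ_γ`; it exceeds the limit at infinity, or `axisEnergy θ_*`, equality
in the latter case being excluded by uniqueness for the differential equation. Finally, as the
Hamiltonian on a vertical line is largest on the axis, an orbit of energy above `axisEnergy θ_*`
never crosses the lines through `θ_*` and through the point of `(0, θ_γ)` with the same axis energy.
-/

/-! ### Phase equations, inverse functions and winding -/

/-- A positive periodic scalar vector field `ω` has a global solution, which advances by one period
of `ω` in a fixed time `T = ∫ 1 / ω`. It is the inverse function of `x ↦ ∫ 1 / ω`. -/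
theorem exists_phase {ω : ℝ → ℝ} (hc : Continuous ω) (hpos : ∀ x, 0 < ω x) {P : ℝ} (hP : 0 < P)
    (hper : Function.Periodic ω P) (x₀ : ℝ) :
    ∃ (χ : ℝ → ℝ) (T : ℝ), 0 < T ∧ χ 0 = x₀ ∧ (∀ t, HasDerivAt χ (ω (χ t)) t) ∧
      ∀ t, χ (t + T) = χ t + P := by
  set ρ : ℝ → ℝ := fun x => (ω x)⁻¹ with hρ
  have hρc : Continuous ρ := hc.inv₀ fun x => (hpos x).ne'
  have hρpos : ∀ x, 0 < ρ x := fun x => inv_pos.2 (hpos x)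
  have hρper : Function.Periodic ρ P := fun x => by simp only [hρ, hper x]
  have hint : ∀ a b, IntervalIntegrable ρ MeasureTheory.volume a b :=
    fun a b => hρc.intervalIntegrable a b
  set τ : ℝ → ℝ := fun x => ∫ y in (0 : ℝ)..x, ρ y with hτ
  have hτd : ∀ x, HasStrictDerivAt τ (ρ x) x := fun x =>
    intervalIntegral.integral_hasStrictDerivAt_right (hint _ _)
      (hρc.stronglyMeasurableAtFilter _ _) hρc.continuousAt
  have hτmono : StrictMono τ := strictMono_of_hasDerivAt_pos
    (fun x => (hτd x).hasDerivAt) hρpos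
  have hτcont : Continuous τ :=
    continuous_iff_continuousAt.2 fun x => (hτd x).hasDerivAt.continuousAt
  have hτsurj : Function.Surjective τ := hτcont.surjective
    (hρper.tendsto_atTop_intervalIntegral_of_pos' (hint _ _) hρpos hP)
    (hρper.tendsto_atBot_intervalIntegral_of_pos' (hint _ _) hρpos hP)
  have hτadd : ∀ x, τ (x + P) = τ x + τ P := fun x => by
    have h1 := hρper.intervalIntegral_add_eq x 0
    have h2 := intervalIntegral.integral_add_adjacent_intervals (hint 0 x) (hint x (x + P))
    simp only [hτ]
    rw [← h2, h1, zero_add]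
  obtain ⟨σ, hσl, hσr⟩ := Function.bijective_iff_has_inverse.1 ⟨hτmono.injective, hτsurj⟩
  have hτ0 : τ 0 = 0 := by simp [hτ]
  refine ⟨fun t => σ (t + τ x₀), τ P, ?_, ?_, fun t => ?_, fun t => ?_⟩
  · rw [← hτ0]
    exact hτmono hP
  · simp only [zero_add]
    exact hσl x₀
  · have h := (hτd (σ (t + τ x₀))).to_local_left_inverse (hρpos _).ne'
      (Filter.Eventually.of_forall hσl)
    rw [hσr] at h
    have h' := h.hasDerivAt.comp_add_const t (τ x₀)
    simpa only [hρ, inv_inv] using h'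
  · apply hτmono.injective
    simp only
    rw [hσr, hτadd, hσr]
    ring

/-- The inverse of a function with positive strict derivative on a segment. -/
theorem exists_inverse_of_strictDeriv_pos {v v' : ℝ → ℝ} {a b : ℝ} (hab : a < b)
    (hd : ∀ x ∈ Set.Icc a b, HasStrictDerivAt v (v' x) x)
    (hpos : ∀ x ∈ Set.Icc a b, 0 < v' x) :
    ∃ Θ : ℝ → ℝ, (∀ x ∈ Set.Icc a b, Θ (v x) = x) ∧
      ∀ y ∈ Set.Ioo (v a) (v b), Θ y ∈ Set.Ioo a b ∧ v (Θ y) = y ∧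
        HasDerivAt Θ (v' (Θ y))⁻¹ y := by
  have hcont : ContinuousOn v (Set.Icc a b) :=
    fun x hx => (hd x hx).hasDerivAt.continuousAt.continuousWithinAt
  have hmono : StrictMonoOn v (Set.Icc a b) := by
    refine strictMonoOn_of_deriv_pos (convex_Icc a b) hcont fun x hx => ?_
    have hx' := interior_subset hx
    rw [(hd x hx').hasDerivAt.deriv]
    exact hpos x hx'
  have hleft : ∀ x ∈ Set.Icc a b, Function.invFunOn v (Set.Icc a b) (v x) = x :=
    fun x hx => hmono.injOn.leftInvOn_invFunOn hx
  refine ⟨Function.invFunOn v (Set.Icc a b), hleft, fun y hy => ?_⟩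
  obtain ⟨x, hx, rfl⟩ := intermediate_value_Ioo hab.le hcont hy
  have hx' := Set.Ioo_subset_Icc_self hx
  rw [hleft x hx']
  refine ⟨hx, rfl, ?_⟩
  refine ((hd x hx').to_local_left_inverse (hpos x hx').ne' ?_).hasDerivAt
  filter_upwards [Ioo_mem_nhds hx.1 hx.2] with z hz
  exact hleft z (Set.Ioo_subset_Icc_self hz)

/-- A curve whose image under the varying stretching `(x, y) ↦ (x / k, y)` has polar angle `χ`
revolves around the centre if `χ` gains a full turn: the stretching changes the angle by less
than `π / 2`, and by the same amount at both ends. -/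
theorem revolvesAround_of_stretched_angle {x y χ R k : ℝ → ℝ} {T a b : ℝ} (hχ : Continuous χ)
    (hk : Continuous k) (hkpos : ∀ t, 0 < k t) (hR : ∀ t, 0 < R t)
    (hx : ∀ t, x t = a + R t * (k t * Real.cos (χ t)))
    (hy : ∀ t, y t = b + R t * Real.sin (χ t)) (hkT : k T = k 0)
    (hχT : χ T = χ 0 + 2 * Real.pi) : OppositeFilaments.RevolvesAround x y T a b := by
  -- `w` is `(k cos χ + i sin χ) exp (-i χ)`
  set w : ℝ → ℂ := fun t => ⟨k t * Real.cos (χ t) ^ 2 + Real.sin (χ t) ^ 2,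
    (1 - k t) * (Real.sin (χ t) * Real.cos (χ t))⟩ with hw
  have hre : ∀ t, 0 < (w t).re := fun t => by
    simp only [hw]
    by_cases h : Real.cos (χ t) = 0
    · have := Real.sin_sq_add_cos_sq (χ t)
      rw [h] at this ⊢
      nlinarith
    · have := hkpos t
      positivity
  have hwc : Continuous w := by
    have : w = fun t => ((k t * Real.cos (χ t) ^ 2 + Real.sin (χ t) ^ 2 : ℝ) : ℂ) +
        (((1 - k t) * (Real.sin (χ t) * Real.cos (χ t)) : ℝ) : ℂ) * Complex.I :=
      funext fun t => Complex.mk_eq_add_mul_I _ _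
    rw [this]
    fun_prop
  refine ⟨fun t => R t * ‖w t‖, fun t => χ t + (w t).arg, ?_, fun t => ⟨?_, ?_, ?_⟩, ?_⟩
  · refine hχ.add (continuous_iff_continuousAt.2 fun t => ?_)
    exact (Complex.continuousAt_arg (Or.inl (hre t))).comp hwc.continuousAt
  · exact mul_pos (hR t) (norm_pos_iff.2 fun h => (hre t).ne' (by rw [h]; rfl))
  · rw [hx, Real.cos_add]
    have h1 := Complex.norm_mul_cos_arg (w t)
    have h2 := Complex.norm_mul_sin_arg (w t)
    have : R t * ‖w t‖ * (Real.cos (χ t) * Real.cos (w t).arg - Real.sin (χ t) *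
        Real.sin (w t).arg) = R t * (Real.cos (χ t) * (w t).re - Real.sin (χ t) * (w t).im) := by
      rw [← h1, ← h2]; ring
    rw [this]
    simp only [hw]
    linear_combination (-(R t * k t * Real.cos (χ t))) * Real.sin_sq_add_cos_sq (χ t)
  · rw [hy, Real.sin_add]
    have h1 := Complex.norm_mul_cos_arg (w t)
    have h2 := Complex.norm_mul_sin_arg (w t)
    have : R t * ‖w t‖ * (Real.sin (χ t) * Real.cos (w t).arg + Real.cos (χ t) *
        Real.sin (w t).arg) = R t * (Real.sin (χ t) * (w t).re + Real.cos (χ t) * (w t).im) := by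
      rw [← h1, ← h2]; ring
    rw [this]
    simp only [hw]
    linear_combination (-(R t * Real.sin (χ t))) * Real.sin_sq_add_cos_sq (χ t)
  · have : w T = w 0 := by
      simp only [hw, hkT, hχT, Real.cos_add_two_pi, Real.sin_add_two_pi]
    simp only [this, hχT]
    have := Real.pi_pos
    intro h
    linarith

/-- A closed curve with nonzero winding number around a point meets every ray issuing from it. -/
theorem exists_mem_ray_of_revolvesAround {x y : ℝ → ℝ} {T a b : ℝ} (hx : x T = x 0)
    (hy : y T = y 0) (h : OppositeFilaments.RevolvesAround x y T a b) (β : ℝ) :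
    ∃ t r : ℝ, 0 < r ∧ x t = a + r * Real.cos β ∧ y t = b + r * Real.sin β := by
  obtain ⟨r, φ, hφ, hr, hne⟩ := h
  obtain ⟨hr0, hx0, hy0⟩ := hr 0
  obtain ⟨hrT, hxT, hyT⟩ := hr T
  have h1 : r T * Real.cos (φ T) = r 0 * Real.cos (φ 0) := by linarith
  have h2 : r T * Real.sin (φ T) = r 0 * Real.sin (φ 0) := by linarith
  have hrr : r T = r 0 := by
    have e1 := Real.sin_sq_add_cos_sq (φ T)
    have e2 := Real.sin_sq_add_cos_sq (φ 0)
    have : r T ^ 2 = r 0 ^ 2 := by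
      calc r T ^ 2 = (r T * Real.cos (φ T)) ^ 2 + (r T * Real.sin (φ T)) ^ 2 := by
            linear_combination (-r T ^ 2) * e1
        _ = r 0 ^ 2 := by rw [h1, h2]; linear_combination (r 0 ^ 2) * e2
    exact (pow_left_inj₀ hrT.le hr0.le two_ne_zero).1 this
  rw [hrr] at h1 h2
  have hang := Real.Angle.cos_sin_inj (mul_left_cancel₀ hr0.ne' h1) (mul_left_cancel₀ hr0.ne' h2)
  obtain ⟨n, hn⟩ := Real.Angle.angle_eq_iff_two_pi_dvd_sub.1 hang
  have hpi := Real.pi_pos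
  have hn0 : n ≠ 0 := by
    rintro rfl
    apply hne
    have : φ T - φ 0 = 0 := by rw [hn]; simp
    linarith
  have hlen : 2 * Real.pi ≤ |φ T - φ 0| := by
    rw [hn, abs_mul, abs_of_pos (by positivity : 0 < 2 * Real.pi)]
    have : (1 : ℝ) ≤ |(n : ℝ)| := by exact_mod_cast Int.one_le_abs hn0
    nlinarith
  obtain ⟨m, hm, -⟩ := existsUnique_add_zsmul_mem_Ico (by positivity : 0 < 2 * Real.pi) β
    (min (φ 0) (φ T))
  have hmem : β + m • (2 * Real.pi) ∈ Set.uIcc (φ 0) (φ T) := by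
    rw [Set.uIcc]
    refine ⟨hm.1, hm.2.le.trans ?_⟩
    have := max_sub_min_eq_abs (φ 0) (φ T)
    have hs : φ 0 ⊓ φ T = min (φ 0) (φ T) := rfl
    have hs' : φ 0 ⊔ φ T = max (φ 0) (φ T) := rfl
    rw [hs']
    linarith
  obtain ⟨t, -, ht⟩ := intermediate_value_uIcc (a := 0) (b := T) hφ.continuousOn hmem
  obtain ⟨hrt, hxt, hyt⟩ := hr t
  refine ⟨t, r t, hrt, ?_, ?_⟩
  · rw [hxt, ht, zsmul_eq_mul, Real.cos_add_int_mul_two_pi]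
  · rw [hyt, ht, zsmul_eq_mul, Real.sin_add_int_mul_two_pi]

/-! ### The potential and the Hamiltonian -/

namespace OppositeFilaments

/-- `cosh θ - g sinh θ`, where `g = √γ`: a multiple of the difference of the radii, which vanishes
exactly at the overlap angle. -/
noncomputable def radiusGap (g θ : ℝ) : ℝ := Real.cosh θ - g * Real.sinh θ

/-- The derivative of `radiusGap g`. -/
noncomputable def radiusGapDeriv (g θ : ℝ) : ℝ := Real.sinh θ - g * Real.cosh θ

theorem hasStrictDerivAt_radiusGap (g θ : ℝ) :
    HasStrictDerivAt (radiusGap g) (radiusGapDeriv g θ) θ :=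
  (Real.hasStrictDerivAt_cosh θ).sub ((Real.hasStrictDerivAt_sinh θ).const_mul g)

theorem hasDerivAt_radiusGapDeriv (g θ : ℝ) :
    HasDerivAt (radiusGapDeriv g) (radiusGap g θ) θ :=
  (Real.hasDerivAt_sinh θ).sub ((Real.hasDerivAt_cosh θ).const_mul g)

theorem continuous_radiusGap (g : ℝ) : Continuous (radiusGap g) := by
  unfold radiusGap; fun_prop

theorem continuous_radiusGapDeriv (g : ℝ) : Continuous (radiusGapDeriv g) := by
  unfold radiusGapDeriv; fun_prop

section
variable {g : ℝ} (hg : 1 < g)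
include hg

theorem radiusGapDeriv_neg (θ : ℝ) : radiusGapDeriv g θ < 0 := by
  have h1 := Real.sinh_lt_cosh θ
  have h2 := Real.cosh_pos θ
  unfold radiusGapDeriv
  nlinarith

theorem strictAnti_radiusGap : StrictAnti (radiusGap g) :=
  strictAnti_of_hasDerivAt_neg (fun θ => (hasStrictDerivAt_radiusGap g θ).hasDerivAt)
    (radiusGapDeriv_neg hg)

theorem thetaOverlap_sq_pos : 0 < thetaOverlap (g ^ 2) :=
  (thetaOverlap_spec (by nlinarith)).1

theorem radiusGap_thetaOverlap : radiusGap g (thetaOverlap (g ^ 2)) = 0 := by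
  have h := (thetaOverlap_spec (γ := g ^ 2) (by nlinarith)).2
  rwa [Real.sqrt_sq (by linarith)] at h

theorem radiusGap_pos_iff {θ : ℝ} : 0 < radiusGap g θ ↔ θ < thetaOverlap (g ^ 2) := by
  rw [← radiusGap_thetaOverlap hg]
  exact (strictAnti_radiusGap hg).lt_iff_gt

theorem radiusGap_neg_iff {θ : ℝ} : radiusGap g θ < 0 ↔ thetaOverlap (g ^ 2) < θ := by
  rw [← radiusGap_thetaOverlap hg]
  exact (strictAnti_radiusGap hg).lt_iff_gt

theorem radiusGap_eq_zero_iff {θ : ℝ} : radiusGap g θ = 0 ↔ θ = thetaOverlap (g ^ 2) := by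
  rw [← radiusGap_thetaOverlap hg]
  exact (strictAnti_radiusGap hg).injective.eq_iff

theorem tendsto_radiusGap_atTop : Filter.Tendsto (radiusGap g) Filter.atTop Filter.atBot := by
  -- `cosh θ - g sinh θ ≤ 1 - (g - 1) θ` for `θ ≥ 0`
  have h : Filter.Tendsto (fun θ : ℝ => 1 + -(g - 1) * θ) Filter.atTop Filter.atBot :=
    Filter.tendsto_atBot_add_const_left _ _
      (Filter.tendsto_id.const_mul_atTop_of_neg (by linarith))
  refine Filter.tendsto_atBot_mono' _ ?_ h
  filter_upwards [Filter.eventually_ge_atTop 0] with θ hθ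
  have h1 : θ ≤ Real.sinh θ := Real.self_le_sinh_iff.2 hθ
  have h2 : Real.cosh θ - Real.sinh θ ≤ 1 := by
    rw [Real.cosh_sub_sinh]
    exact Real.exp_le_one_iff.2 (by linarith)
  unfold radiusGap
  nlinarith

end

/-- The self-induced part of the Hamiltonian, for `γ = g²` and `d = s²`. -/
noncomputable def potential (g s θ : ℝ) : ℝ :=
  1 / s * (2 * g ^ 3 * Real.arctan (Real.tanh (θ / 2)) + Real.log (Real.tanh (θ / 2)))

/-- The derivative of `potential g s`. -/
noncomputable def potentialDeriv (g s θ : ℝ) : ℝ :=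
  1 / s * (g ^ 3 / Real.cosh θ + 1 / Real.sinh θ)

theorem hasStrictDerivAt_tanh (x : ℝ) :
    HasStrictDerivAt Real.tanh (1 / Real.cosh x ^ 2) x := by
  have h := (Real.hasStrictDerivAt_sinh x).fun_div (Real.hasStrictDerivAt_cosh x)
    (Real.cosh_pos x).ne'
  have e : (fun x => Real.sinh x / Real.cosh x) = Real.tanh :=
    funext fun x => (Real.tanh_eq_sinh_div_cosh x).symm
  rw [e] at h
  refine h.congr_deriv ?_
  rw [← sq, ← sq, Real.cosh_sq]
  ring

theorem strictMono_tanh : StrictMono Real.tanh :=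
  strictMono_of_hasDerivAt_pos (fun x => (hasStrictDerivAt_tanh x).hasDerivAt) fun x => by
    have := Real.cosh_pos x
    positivity

theorem tanh_half_pos {θ : ℝ} (hθ : 0 < θ) : 0 < Real.tanh (θ / 2) := by
  rw [Real.tanh_eq_sinh_div_cosh]
  exact div_pos (Real.sinh_pos_iff.2 (by linarith)) (Real.cosh_pos _)

theorem hasStrictDerivAt_potential (g s : ℝ) {θ : ℝ} (hθ : 0 < θ) :
    HasStrictDerivAt (potential g s) (potentialDeriv g s θ) θ := by
  have hS : 0 < Real.sinh (θ / 2) := Real.sinh_pos_iff.2 (by linarith)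
  have hC := Real.cosh_pos (θ / 2)
  have ht : HasStrictDerivAt (fun x : ℝ => Real.tanh (x / 2))
      (1 / Real.cosh (θ / 2) ^ 2 * (1 / 2)) θ :=
    HasStrictDerivAt.comp θ (h := fun x : ℝ => x / 2) (hasStrictDerivAt_tanh (θ / 2))
      ((hasStrictDerivAt_id θ).div_const 2)
  have h := (((ht.arctan).const_mul (2 * g ^ 3)).add (ht.log (tanh_half_pos hθ).ne')).const_mul
    (1 / s)
  have h1 : Real.cosh θ = Real.cosh (θ / 2) ^ 2 + Real.sinh (θ / 2) ^ 2 := by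
    rw [← Real.cosh_two_mul]; ring_nf
  have h2 : Real.sinh θ = 2 * Real.sinh (θ / 2) * Real.cosh (θ / 2) := by
    rw [← Real.sinh_two_mul]; ring_nf
  refine h.congr_deriv ?_
  rw [potentialDeriv, h1, h2, Real.tanh_eq_sinh_div_cosh]
  field_simp

theorem hasDerivAt_potentialDeriv (g s : ℝ) {θ : ℝ} (hθ : 0 < θ) :
    HasDerivAt (potentialDeriv g s) (1 / s * (-(g ^ 3 * Real.sinh θ / Real.cosh θ ^ 2) -
      Real.cosh θ / Real.sinh θ ^ 2)) θ := by
  have hS := Real.sinh_pos_iff.2 hθ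
  have h1 := (Real.hasDerivAt_cosh θ).fun_inv (Real.cosh_pos θ).ne'
  have h2 := (Real.hasDerivAt_sinh θ).fun_inv hS.ne'
  have h := ((h1.const_mul (g ^ 3)).add h2).const_mul (1 / s)
  have e : potentialDeriv g s = fun x => 1 / s * (g ^ 3 * (Real.cosh x)⁻¹ + (Real.sinh x)⁻¹) := by
    funext x; simp only [potentialDeriv]; ring
  rw [e]
  refine h.congr_deriv ?_
  ring

theorem tendsto_tanh_atTop : Filter.Tendsto Real.tanh Filter.atTop (nhds 1) := by
  -- `1 - tanh x = exp (-x) / cosh x` lies between `0` and `exp (-x)`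
  have h : Filter.Tendsto (fun x : ℝ => 1 - Real.exp (-x)) Filter.atTop (nhds (1 - 0)) :=
    tendsto_const_nhds.sub (Real.tendsto_exp_neg_atTop_nhds_zero)
  rw [sub_zero] at h
  refine tendsto_of_tendsto_of_tendsto_of_le_of_le h tendsto_const_nhds (fun x => ?_)
    (fun x => (Real.tanh_lt_one x).le)
  simp only
  rw [Real.tanh_eq_sinh_div_cosh, le_div_iff₀ (Real.cosh_pos x), ← Real.cosh_sub_sinh]
  have h1 := Real.one_le_cosh x
  have h2 := Real.sinh_lt_cosh x
  nlinarith

section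
variable {g s : ℝ} (hg : 1 < g) (hs : 0 < s)
include hg hs

theorem potentialDeriv_pos {θ : ℝ} (hθ : 0 < θ) : 0 < potentialDeriv g s θ := by
  have hS := Real.sinh_pos_iff.2 hθ
  have hC := Real.cosh_pos θ
  unfold potentialDeriv
  positivity

omit hg hs in
theorem continuousOn_potential (g s : ℝ) : ContinuousOn (potential g s) (Set.Ioi 0) :=
  fun _ hx => (hasStrictDerivAt_potential g s hx).hasDerivAt.continuousAt.continuousWithinAt

theorem strictMonoOn_potential : StrictMonoOn (potential g s) (Set.Ioi 0) := by
  refine strictMonoOn_of_deriv_pos (convex_Ioi 0) (continuousOn_potential g s) fun x hx => ?_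
  rw [interior_Ioi] at hx
  rw [(hasStrictDerivAt_potential g s hx).hasDerivAt.deriv]
  exact potentialDeriv_pos hg hs hx

omit hg hs in
theorem tendsto_potential_atTop (g s : ℝ) : Filter.Tendsto (potential g s) Filter.atTop
    (nhds (Real.pi * g ^ 3 / (2 * s))) := by
  have h1 : Filter.Tendsto (fun θ : ℝ => Real.tanh (θ / 2)) Filter.atTop (nhds 1) :=
    tendsto_tanh_atTop.comp (Filter.tendsto_id.atTop_div_const two_pos)
  have h2 := (Real.continuous_arctan.tendsto 1).comp h1
  have h3 := h1.log one_ne_zero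
  have h := ((h2.const_mul (2 * g ^ 3)).add h3).const_mul (1 / s)
  rw [Real.arctan_one, Real.log_one] at h
  have e : 1 / s * (2 * g ^ 3 * (Real.pi / 4) + 0) = Real.pi * g ^ 3 / (2 * s) := by
    field_simp; ring
  rwa [e] at h

omit hg in
theorem tendsto_potential_zero : Filter.Tendsto (potential g s) (nhdsWithin 0 (Set.Ioi 0))
    Filter.atBot := by
  have h0 : Filter.Tendsto (fun θ : ℝ => Real.tanh (θ / 2)) (nhdsWithin 0 (Set.Ioi 0))
      (nhds 0) := by
    have h : ContinuousAt (fun θ : ℝ => Real.tanh (θ / 2)) 0 :=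
      ((hasStrictDerivAt_tanh (0 / 2)).hasDerivAt.continuousAt).comp
        (f := fun θ : ℝ => θ / 2) (by fun_prop)
    have h' := h.tendsto
    simp only [zero_div, Real.tanh_zero] at h'
    exact h'.mono_left nhdsWithin_le_nhds
  have h1 : Filter.Tendsto (fun θ : ℝ => Real.tanh (θ / 2)) (nhdsWithin 0 (Set.Ioi 0))
      (nhdsWithin 0 (Set.Ioi 0)) := by
    refine tendsto_nhdsWithin_iff.2 ⟨h0, ?_⟩
    filter_upwards [self_mem_nhdsWithin] with θ hθ
    exact tanh_half_pos hθ
  have h2 := (((Real.continuous_arctan.tendsto 0).comp h0).const_mul (2 * g ^ 3)).add_atBot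
    (Real.tendsto_log_nhdsGT_zero.comp h1)
  exact h2.const_mul_atBot (by positivity)

end

/-- The value of the Hamiltonian on the axis `W = 0`, as a function of `θ`. -/
noncomputable def axisEnergy (α g s θ : ℝ) : ℝ :=
  potential g s θ + α * g ^ 2 / s / |radiusGap g θ|

theorem rpow_three_halves_sq {x : ℝ} (hx : 0 ≤ x) : (x ^ 2) ^ (3 / 2 : ℝ) = x ^ 3 := by
  rw [← Real.rpow_natCast, ← Real.rpow_mul hx, ← Real.rpow_natCast]
  norm_num

section
variable {α g s : ℝ} (hα : 0 < α) (hg : 1 < g) (hs : 0 < s)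
include hg

theorem sqDist_eq (s θ W : ℝ) :
    sqDist (g ^ 2) (s ^ 2) θ W = (s / g * radiusGap g θ) ^ 2 + W ^ 2 := by
  rw [sqDist, Real.sqrt_sq (by linarith), radiusGap]
  ring

theorem sqDist_pos (hs : 0 < s) {θ W : ℝ} (h : (θ, W) ∈ phaseSpace (g ^ 2)) :
    0 < sqDist (g ^ 2) (s ^ 2) θ W := by
  rw [sqDist_eq hg]
  by_cases hW : W = 0
  · have : radiusGap g θ ≠ 0 := fun h0 =>
      h.2 (by rw [(radiusGap_eq_zero_iff hg).1 h0, hW])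
    have : s / g * radiusGap g θ ≠ 0 := mul_ne_zero (by positivity) this
    positivity
  · positivity

include hs

theorem hamiltonian_eq (α θ W : ℝ) : hamiltonian α (g ^ 2) (s ^ 2) θ W =
    potential g s θ + α * g / √(sqDist (g ^ 2) (s ^ 2) θ W) := by
  rw [hamiltonian, potential, Real.sqrt_sq hs.le, Real.sqrt_sq (by linarith),
    rpow_three_halves_sq (by linarith)]

theorem hamiltonian_axis (α θ : ℝ) :
    hamiltonian α (g ^ 2) (s ^ 2) θ 0 = axisEnergy α g s θ := by
  have hg0 : 0 < g := by linarith
  rw [hamiltonian_eq hg hs, sqDist_eq hg, axisEnergy]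
  simp only [ne_eq, OfNat.ofNat_ne_zero, not_false_eq_true, zero_pow, add_zero]
  rw [Real.sqrt_sq_eq_abs, abs_mul, abs_of_pos (by positivity : 0 < s / g)]
  field_simp

omit hs in
theorem fieldTheta_eq (α θ W : ℝ) : fieldTheta α (g ^ 2) (s ^ 2) θ W =
    -(α * g * W / √(sqDist (g ^ 2) (s ^ 2) θ W) ^ 3) := by
  have hQ : 0 ≤ sqDist (g ^ 2) (s ^ 2) θ W := by rw [sqDist_eq hg]; positivity
  rw [fieldTheta, Real.sqrt_sq (by linarith), ← rpow_three_halves_sq (Real.sqrt_nonneg _),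
    Real.sq_sqrt hQ]

theorem fieldW_eq (α θ W : ℝ) : fieldW α (g ^ 2) (s ^ 2) θ W =
    -potentialDeriv g s θ + α * s ^ 2 * radiusGapDeriv g θ * radiusGap g θ /
      (g * √(sqDist (g ^ 2) (s ^ 2) θ W) ^ 3) := by
  have hQ : 0 ≤ sqDist (g ^ 2) (s ^ 2) θ W := by rw [sqDist_eq hg]; positivity
  have h1 : √(s ^ 2) = s := Real.sqrt_sq hs.le
  have h2 : √(g ^ 2) = g := Real.sqrt_sq (by linarith)
  rw [fieldW, h1, h2, rpow_three_halves_sq (by linarith),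
    ← rpow_three_halves_sq (Real.sqrt_nonneg (sqDist (g ^ 2) (s ^ 2) θ W)),
    Real.sq_sqrt hQ, potentialDeriv, radiusGapDeriv, radiusGap]
  ring

include hα

/-- On each vertical line the Hamiltonian is largest on the axis `W = 0`. -/
theorem hamiltonian_le_axisEnergy {θ : ℝ} (hθ : radiusGap g θ ≠ 0) (W : ℝ) :
    hamiltonian α (g ^ 2) (s ^ 2) θ W ≤ axisEnergy α g s θ := by
  have hg0 : 0 < g := by linarith
  rw [← hamiltonian_axis hg hs, hamiltonian_eq hg hs, hamiltonian_eq hg hs, sqDist_eq hg,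
    sqDist_eq hg]
  have : s / g * radiusGap g θ ≠ 0 := mul_ne_zero (by positivity) hθ
  gcongr ?_ + α * g / ?_
  · exact le_rfl
  · exact Real.sqrt_le_sqrt (by nlinarith [sq_nonneg W])

end

/-! ### The axis energy and the equilibria -/

/-- With `t = tanh θ`, a point `(θ, 0)` beyond the overlap is an equilibrium if and only if
`criticalRatio g t = α g²`. -/
noncomputable def criticalRatio (g t : ℝ) : ℝ :=
  (g ^ 3 * t + 1) * (g * t - 1) ^ 2 / (t * (g - t))

theorem criticalRatio_one {g : ℝ} (hg : 1 < g) :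
    criticalRatio g 1 = (g ^ 3 + 1) * (g - 1) := by
  have : g - 1 ≠ 0 := by linarith
  rw [criticalRatio]
  field_simp

theorem strictMonoOn_criticalRatio {g : ℝ} (hg : 1 < g) :
    StrictMonoOn (criticalRatio g) (Set.Icc (1 / g) 1) := by
  have hg0 : 0 < g := by linarith
  rintro x ⟨hx, -⟩ y ⟨-, hy⟩ hxy
  have hx0 : 0 < x := lt_of_lt_of_le (by positivity) hx
  have hgx : 1 ≤ g * x := by rwa [div_le_iff₀' hg0] at hx
  have hy0 : 0 < y := hx0.trans hxy
  have e : ∀ t, criticalRatio g t = (g ^ 3 * t + 1) / (g - t) * ((g * t - 1) ^ 2 / t) :=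
    fun t => by rw [criticalRatio, div_mul_div_comm, mul_comm (g - t) t]
  rw [e, e]
  have hgx' : 0 < g - x := by linarith
  have hgy' : 0 < g - y := by linarith
  have hgxy : g * x < g * y := by gcongr
  refine mul_lt_mul'' ?_ ?_ (by positivity) (by positivity)
  · have : g ^ 3 * x < g ^ 3 * y := by gcongr
    gcongr
  · rw [div_lt_div_iff₀ hx0 hy0]
    have : 1 < g ^ 2 * (x * y) := by nlinarith
    nlinarith [mul_pos (sub_pos.2 hxy) (sub_pos.2 this)]

theorem continuousOn_criticalRatio {g : ℝ} (hg : 1 < g) :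
    ContinuousOn (criticalRatio g) (Set.Icc (1 / g) 1) := by
  unfold criticalRatio
  refine ContinuousOn.div (by fun_prop) (by fun_prop) fun x hx => ?_
  have hx0 : 0 < x := lt_of_lt_of_le (by positivity) hx.1
  have : g - x ≠ 0 := by linarith [hx.2]
  exact mul_ne_zero hx0.ne' this

/-- The parameter threshold is governed by the increasing function `(g³ + 1)(g - 1) / g²`. -/
theorem threshold_mono {x y : ℝ} (hx : 1 < x) (hxy : x < y) :
    (x ^ 3 + 1) * (x - 1) / x ^ 2 < (y ^ 3 + 1) * (y - 1) / y ^ 2 := by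
  have hx0 : 0 < x := by linarith
  have hy0 : 0 < y := by linarith
  have hp : 1 < x * y := by nlinarith
  have hinv : 1 / (x * y) < 1 := by rw [div_lt_one (by positivity)]; exact hp
  have key : (y ^ 3 + 1) * (y - 1) / y ^ 2 - (x ^ 3 + 1) * (x - 1) / x ^ 2 =
      (y - x) * (x + y - 1 - 1 / (x * y) + (x + y) / (x * y) ^ 2) := by
    field_simp
    ring
  have : 0 < (x + y) / (x * y) ^ 2 := by positivity
  have : 0 < (y - x) * (x + y - 1 - 1 / (x * y) + (x + y) / (x * y) ^ 2) :=
    mul_pos (by linarith) (by linarith)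
  linarith

theorem exists_threshold {α : ℝ} (hα : 0 < α) :
    ∃ g : ℝ, 1 < g ∧ (g ^ 3 + 1) * (g - 1) / g ^ 2 = α := by
  have hc : ContinuousOn (fun g : ℝ => (g ^ 3 + 1) * (g - 1) / g ^ 2) (Set.Icc 1 (α + 2)) :=
    ContinuousOn.div (by fun_prop) (by fun_prop) fun x hx => by
      have : 0 < x := by linarith [hx.1]
      positivity
  obtain ⟨g, hg, he⟩ := intermediate_value_Ioo (by linarith) hc (show α ∈ Set.Ioo _ _ from by
    constructor
    · norm_num; exact hα
    · rw [lt_div_iff₀ (by positivity)]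
      have : 0 < α ^ 2 := by positivity
      nlinarith [pow_pos hα 3, pow_pos hα 4])
  exact ⟨g, hg.1, he⟩

/-- The derivative of `axisEnergy` beyond the overlap. -/
noncomputable def axisSlope (α g s θ : ℝ) : ℝ :=
  potentialDeriv g s θ + α * g ^ 2 / s * (radiusGapDeriv g θ / radiusGap g θ ^ 2)

section
variable {α g s : ℝ} (hα : 0 < α) (hg : 1 < g) (hs : 0 < s)
include hg

theorem tanh_mem_of_thetaOverlap_lt {θ : ℝ} (hθ : thetaOverlap (g ^ 2) < θ) :
    Real.tanh θ ∈ Set.Ioo (1 / g) 1 := by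
  refine ⟨?_, Real.tanh_lt_one θ⟩
  have h := (radiusGap_neg_iff hg).2 hθ
  rw [radiusGap] at h
  rw [Real.tanh_eq_sinh_div_cosh, div_lt_div_iff₀ (by linarith) (Real.cosh_pos θ)]
  linarith

theorem axisSlope_eq (α s : ℝ) {θ : ℝ} (hθ : thetaOverlap (g ^ 2) < θ) :
    axisSlope α g s θ = 1 / s * (-radiusGapDeriv g θ / radiusGap g θ ^ 2) *
      (criticalRatio g (Real.tanh θ) - α * g ^ 2) := by
  have hc := (radiusGap_neg_iff hg).2 hθ
  have hS := Real.sinh_pos_iff.2 ((thetaOverlap_sq_pos hg).trans hθ)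
  have hC := Real.cosh_pos θ
  have hd := radiusGapDeriv_neg hg θ
  have e : criticalRatio g (Real.tanh θ) = (g ^ 3 / Real.cosh θ + 1 / Real.sinh θ) *
      radiusGap g θ ^ 2 / -radiusGapDeriv g θ := by
    rw [radiusGapDeriv] at hd ⊢
    have h1 : g * Real.cosh θ - Real.sinh θ ≠ 0 := by linarith
    have h2 : Real.sinh θ - g * Real.cosh θ ≠ 0 := hd.ne
    rw [criticalRatio, radiusGap, Real.tanh_eq_sinh_div_cosh, neg_sub]
    field_simp
    ring
  rw [e, axisSlope, potentialDeriv]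
  have h1 := hc.ne
  have h2 := hd.ne
  by_cases h0 : s = 0
  · simp [h0]
  · field_simp
    ring

theorem hasDerivAt_axisEnergy_of_gt (α s : ℝ) {θ : ℝ} (hθ : thetaOverlap (g ^ 2) < θ) :
    HasDerivAt (axisEnergy α g s) (axisSlope α g s θ) θ := by
  have hc := (radiusGap_neg_iff hg).2 hθ
  have hp := (hasStrictDerivAt_potential g s ((thetaOverlap_sq_pos hg).trans hθ)).hasDerivAt
  have hr := ((hasStrictDerivAt_radiusGap g θ).hasDerivAt.fun_inv hc.ne).const_mul
    (-(α * g ^ 2 / s))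
  refine ((hp.add hr).congr_deriv ?_).congr_of_eventuallyEq ?_
  · rw [axisSlope]; ring
  · filter_upwards [lt_mem_nhds hθ] with x hx
    have := (radiusGap_neg_iff hg).2 hx
    simp only [axisEnergy, abs_of_neg this, Pi.add_apply]
    rw [div_neg]
    ring

theorem hasDerivAt_axisEnergy_of_lt (α s : ℝ) {θ : ℝ} (h0 : 0 < θ)
    (hθ : θ < thetaOverlap (g ^ 2)) :
    HasDerivAt (axisEnergy α g s) (potentialDeriv g s θ +
      α * g ^ 2 / s * (-radiusGapDeriv g θ / radiusGap g θ ^ 2)) θ := by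
  have hc := (radiusGap_pos_iff hg).2 hθ
  have hp := (hasStrictDerivAt_potential g s h0).hasDerivAt
  have hr := ((hasStrictDerivAt_radiusGap g θ).hasDerivAt.fun_inv hc.ne').const_mul
    (α * g ^ 2 / s)
  refine (hp.add hr).congr_of_eventuallyEq ?_
  filter_upwards [gt_mem_nhds hθ] with x hx
  have := (radiusGap_pos_iff hg).2 hx
  simp only [axisEnergy, abs_of_pos this, Pi.add_apply]
  ring

theorem tendsto_axisEnergy_atTop (α s : ℝ) : Filter.Tendsto (axisEnergy α g s) Filter.atTop
    (nhds (Real.pi * g ^ 3 / (2 * s))) := by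
  have h1 := (tendsto_potential_atTop g s).add
    ((Filter.tendsto_abs_atBot_atTop.comp (tendsto_radiusGap_atTop hg)).const_div_atTop
      (α * g ^ 2 / s))
  rw [add_zero] at h1
  exact h1

include hs

omit hg in
theorem tendsto_axisEnergy_zero (α : ℝ) : Filter.Tendsto (axisEnergy α g s)
    (nhdsWithin 0 (Set.Ioi 0)) Filter.atBot := by
  have h : ContinuousAt (fun θ => α * g ^ 2 / s / |radiusGap g θ|) 0 := by
    refine continuousAt_const.div (continuous_radiusGap g).abs.continuousAt ?_
    simp [radiusGap]
  exact (tendsto_potential_zero hs).atBot_add (h.tendsto.mono_left nhdsWithin_le_nhds)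

include hα

theorem strictMonoOn_axisEnergy :
    StrictMonoOn (axisEnergy α g s) (Set.Ioo 0 (thetaOverlap (g ^ 2))) := by
  refine strictMonoOn_of_deriv_pos (convex_Ioo _ _) (fun x hx =>
    (hasDerivAt_axisEnergy_of_lt hg α s hx.1 hx.2).continuousAt.continuousWithinAt) fun x hx => ?_
  rw [interior_Ioo] at hx
  rw [(hasDerivAt_axisEnergy_of_lt hg α s hx.1 hx.2).deriv]
  have h1 := potentialDeriv_pos hg hs hx.1
  have h2 := radiusGapDeriv_neg hg x
  have h3 := (radiusGap_pos_iff hg).2 hx.2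
  have : 0 < -radiusGapDeriv g x := by linarith
  positivity

/-- Near the overlap the interaction energy blows up. -/
theorem tendsto_axisEnergy_thetaOverlap : Filter.Tendsto (axisEnergy α g s)
    (nhdsWithin (thetaOverlap (g ^ 2)) {thetaOverlap (g ^ 2)}ᶜ) Filter.atTop := by
  have hp : Filter.Tendsto (potential g s) (nhdsWithin (thetaOverlap (g ^ 2))
      {thetaOverlap (g ^ 2)}ᶜ) (nhds (potential g s (thetaOverlap (g ^ 2)))) :=
    (hasStrictDerivAt_potential g s
      (thetaOverlap_sq_pos hg)).hasDerivAt.continuousAt.tendsto.mono_left nhdsWithin_le_nhds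
  have hr : Filter.Tendsto (fun θ => |radiusGap g θ|) (nhdsWithin (thetaOverlap (g ^ 2))
      {thetaOverlap (g ^ 2)}ᶜ) (nhdsWithin 0 (Set.Ioi 0)) := by
    refine tendsto_nhdsWithin_iff.2 ⟨?_, ?_⟩
    · have h := ((continuous_radiusGap g).abs.tendsto (thetaOverlap (g ^ 2)))
      rw [radiusGap_thetaOverlap hg, abs_zero] at h
      exact h.mono_left nhdsWithin_le_nhds
    · filter_upwards [self_mem_nhdsWithin] with θ hθ
      exact abs_pos.2 fun h => hθ ((radiusGap_eq_zero_iff hg).1 h)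
  have hg0 : 0 < g := by linarith
  exact hp.add_atTop ((tendsto_inv_nhdsGT_zero.comp hr).const_mul_atTop
    (by positivity : 0 < α * g ^ 2 / s))

/-- On `(0, θ_γ)` the axis energy takes every value. -/
theorem exists_axisEnergy_eq (E : ℝ) :
    ∃ θ ∈ Set.Ioo 0 (thetaOverlap (g ^ 2)), axisEnergy α g s θ = E := by
  have hO := thetaOverlap_sq_pos hg
  obtain ⟨a, ha, ha'⟩ := (((tendsto_axisEnergy_zero hs α).eventually_lt_atBot E).and
    (Ioo_mem_nhdsGT hO)).exists
  have hlt : Filter.Tendsto (axisEnergy α g s) (nhdsWithin (thetaOverlap (g ^ 2))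
      (Set.Iio (thetaOverlap (g ^ 2)))) Filter.atTop :=
    (tendsto_axisEnergy_thetaOverlap hα hg hs).mono_left
      (nhdsWithin_mono _ fun x (hx : x < _) => hx.ne)
  obtain ⟨b, hb, hb'⟩ := ((hlt.eventually_gt_atTop E).and
    (Ioo_mem_nhdsLT ha'.2)).exists
  obtain ⟨θ, hθ, he⟩ := intermediate_value_Ioo hb'.1.le (f := axisEnergy α g s) (fun x hx =>
    (hasDerivAt_axisEnergy_of_lt hg α s (ha'.1.trans_le hx.1)
      (hx.2.trans_lt hb'.2)).continuousAt.continuousWithinAt) (show E ∈ Set.Ioo _ _ from ⟨ha, hb⟩)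
  exact ⟨θ, ⟨ha'.1.trans hθ.1, hθ.2.trans hb'.2⟩, he⟩

omit hα in
/-- On the axis, the field in the `W` direction is minus the slope of the axis energy. -/
theorem fieldW_axis_of_gt (α : ℝ) {θ : ℝ} (hθ : thetaOverlap (g ^ 2) < θ) :
    fieldW α (g ^ 2) (s ^ 2) θ 0 = -axisSlope α g s θ := by
  have hc := (radiusGap_neg_iff hg).2 hθ
  have hg0 : 0 < g := by linarith
  rw [fieldW_eq hg hs, sqDist_eq hg, axisSlope]
  simp only [ne_eq, OfNat.ofNat_ne_zero, not_false_eq_true, zero_pow, add_zero]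
  rw [Real.sqrt_sq_eq_abs, abs_mul, abs_of_pos (by positivity : 0 < s / g), abs_of_neg hc]
  have := hc.ne
  have h2 : -radiusGap g θ ≠ 0 := neg_ne_zero.2 this
  have h3 : (-radiusGap g θ) ^ 3 = -(radiusGap g θ ^ 3) := by ring
  rw [mul_pow, h3]
  field_simp
  ring

theorem fieldW_axis_of_lt {θ : ℝ} (h0 : 0 < θ) (hθ : θ < thetaOverlap (g ^ 2)) :
    fieldW α (g ^ 2) (s ^ 2) θ 0 < 0 := by
  have hc := (radiusGap_pos_iff hg).2 hθ
  have hg0 : 0 < g := by linarith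
  have h1 := potentialDeriv_pos hg hs h0
  have h2 : 0 < -radiusGapDeriv g θ := by linarith [radiusGapDeriv_neg hg θ]
  rw [fieldW_eq hg hs, sqDist_eq hg]
  have h3 : 0 < √((s / g * radiusGap g θ) ^ 2 + 0 ^ 2) := Real.sqrt_pos.2 (by positivity)
  have h4 : 0 < α * s ^ 2 * -radiusGapDeriv g θ * radiusGap g θ /
      (g * √((s / g * radiusGap g θ) ^ 2 + 0 ^ 2) ^ 3) := by positivity
  rw [mul_neg, neg_mul, neg_div] at h4
  linarith

/-- All equilibria lie on the axis beyond the overlap, at the zeros of the slope. -/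
theorem isEquilibrium_iff (p : ℝ × ℝ) : IsEquilibrium α (g ^ 2) (s ^ 2) p ↔
    p.2 = 0 ∧ thetaOverlap (g ^ 2) < p.1 ∧ criticalRatio g (Real.tanh p.1) = α * g ^ 2 := by
  obtain ⟨θ, W⟩ := p
  have hg0 : 0 < g := by linarith
  have hslope : thetaOverlap (g ^ 2) < θ →
      (axisSlope α g s θ = 0 ↔ criticalRatio g (Real.tanh θ) = α * g ^ 2) := fun hθ => by
    have h1 : -radiusGapDeriv g θ ≠ 0 := by linarith [radiusGapDeriv_neg hg θ]
    have h2 := ((radiusGap_neg_iff hg).2 hθ).ne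
    rw [axisSlope_eq hg α s hθ, mul_eq_zero, sub_eq_zero, or_iff_right]
    positivity
  constructor
  · rintro ⟨hmem, hT, hW⟩
    have hQ := sqDist_pos hg hs hmem
    simp only at hT hW ⊢
    have hW0 : W = 0 := by
      rw [fieldTheta_eq hg, neg_eq_zero, div_eq_zero_iff] at hT
      have h1 : √(sqDist (g ^ 2) (s ^ 2) θ W) ^ 3 ≠ 0 := by positivity
      have h2 : α * g ≠ 0 := by positivity
      simpa [h1, h2, hα.ne', hg0.ne'] using hT
    subst hW0
    have hθ : thetaOverlap (g ^ 2) < θ := by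
      rcases lt_trichotomy θ (thetaOverlap (g ^ 2)) with h | h | h
      · exact absurd hW (fieldW_axis_of_lt hα hg hs hmem.1 h).ne
      · exact absurd (by rw [h]) hmem.2
      · exact h
    rw [fieldW_axis_of_gt hg hs α hθ, neg_eq_zero] at hW
    exact ⟨rfl, hθ, (hslope hθ).1 hW⟩
  · rintro ⟨hW0, hθ, hcrit⟩
    simp only at hW0 hθ hcrit
    subst hW0
    refine ⟨⟨(thetaOverlap_sq_pos hg).trans hθ, fun h => hθ.ne' (Prod.ext_iff.1 h).1⟩, ?_, ?_⟩
    · simp [fieldTheta]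
    · simp only
      rw [fieldW_axis_of_gt hg hs α hθ, (hslope hθ).2 hcrit, neg_zero]

omit hα hs in
theorem continuousOn_axisEnergy_of_gt (α s : ℝ) :
    ContinuousOn (axisEnergy α g s) (Set.Ioi (thetaOverlap (g ^ 2))) :=
  fun _ hx => (hasDerivAt_axisEnergy_of_gt hg α s hx).continuousAt.continuousWithinAt

omit hα in
theorem axisSlope_neg_iff (α : ℝ) {θ : ℝ} (hθ : thetaOverlap (g ^ 2) < θ) :
    axisSlope α g s θ < 0 ↔ criticalRatio g (Real.tanh θ) < α * g ^ 2 := by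
  have h1 : 0 < -radiusGapDeriv g θ := by linarith [radiusGapDeriv_neg hg θ]
  have h2 := ((radiusGap_neg_iff hg).2 hθ).ne
  rw [axisSlope_eq hg α s hθ, ← neg_pos, ← mul_neg, mul_pos_iff_of_pos_left (by positivity),
    neg_pos, sub_neg]

omit hα in
theorem axisSlope_pos_iff (α : ℝ) {θ : ℝ} (hθ : thetaOverlap (g ^ 2) < θ) :
    0 < axisSlope α g s θ ↔ α * g ^ 2 < criticalRatio g (Real.tanh θ) := by
  have h1 : 0 < -radiusGapDeriv g θ := by linarith [radiusGapDeriv_neg hg θ]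
  have h2 := ((radiusGap_neg_iff hg).2 hθ).ne
  rw [axisSlope_eq hg α s hθ, mul_pos_iff_of_pos_left (by positivity), sub_pos]

end

/-! ### Energy levels as closed orbits -/

/-- The energy `F + F' c / c'`, with `F` the potential and `c` the radius gap. Beyond the overlap,
`levelCos` on the level `E` has positive derivative at `θ` exactly when this is less than `E`. -/
noncomputable def turningEnergy (g s θ : ℝ) : ℝ :=
  potential g s θ + potentialDeriv g s θ * (radiusGap g θ / radiusGapDeriv g θ)

/-- On the level `E` of the Hamiltonian, the distance `√Q` as a function of `θ`. -/
noncomputable def levelRadius (α g s E θ : ℝ) : ℝ := α * g / (E - potential g s θ)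

/-- On the level `E` of the Hamiltonian, the cosine of the phase as a function of `θ`: the phase is
the polar angle of the point `(-(s / g) (cosh θ - g sinh θ), W)`. -/
noncomputable def levelCos (α g s E θ : ℝ) : ℝ :=
  -(s / (α * g ^ 2)) * (radiusGap g θ * (E - potential g s θ))

/-- The derivative of `levelCos α g s E`. -/
noncomputable def levelCosDeriv (α g s E θ : ℝ) : ℝ :=
  -(s / (α * g ^ 2)) * (radiusGapDeriv g θ * (E - potential g s θ) +
    radiusGap g θ * -potentialDeriv g s θ)

theorem hasStrictDerivAt_levelCos (α g s E : ℝ) {θ : ℝ} (hθ : 0 < θ) :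
    HasStrictDerivAt (levelCos α g s E) (levelCosDeriv α g s E θ) θ :=
  ((hasStrictDerivAt_radiusGap g θ).mul
    ((hasStrictDerivAt_potential g s hθ).const_sub E)).const_mul _

theorem continuousAt_levelCosDeriv (α g s E : ℝ) {θ : ℝ} (hθ : 0 < θ) :
    ContinuousAt (levelCosDeriv α g s E) θ := by
  have h1 := (continuous_radiusGapDeriv g).continuousAt (x := θ)
  have h2 := (continuous_radiusGap g).continuousAt (x := θ)
  have h3 := (hasStrictDerivAt_potential g s hθ).hasDerivAt.continuousAt
  have h4 := (hasDerivAt_potentialDeriv g s hθ).continuousAt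
  exact continuousAt_const.mul ((h1.mul (continuousAt_const.sub h3)).add (h2.mul h4.neg))

section
variable {α g s E : ℝ} (hα : 0 < α) (hg : 1 < g) (hs : 0 < s)
include hg hs

theorem hasDerivAt_turningEnergy {θ : ℝ} (hθ : 0 < θ) :
    HasDerivAt (turningEnergy g s)
      (potentialDeriv g s θ * (2 - (radiusGap g θ / radiusGapDeriv g θ) ^ 2) +
        1 / s * (-(g ^ 3 * Real.sinh θ / Real.cosh θ ^ 2) - Real.cosh θ / Real.sinh θ ^ 2) *
          (radiusGap g θ / radiusGapDeriv g θ)) θ := by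
  have hd := (radiusGapDeriv_neg hg θ).ne
  have h1 := (hasStrictDerivAt_potential g s hθ).hasDerivAt
  have h2 := hasDerivAt_potentialDeriv g s hθ
  have h3 := (hasStrictDerivAt_radiusGap g θ).hasDerivAt.fun_div (hasDerivAt_radiusGapDeriv g θ) hd
  refine (h1.add (h2.mul h3)).congr_deriv ?_
  field_simp
  ring

theorem monotoneOn_turningEnergy :
    MonotoneOn (turningEnergy g s) (Set.Ioi (thetaOverlap (g ^ 2))) := by
  have hO := thetaOverlap_sq_pos hg
  have hd : ∀ x ∈ Set.Ioi (thetaOverlap (g ^ 2)), HasDerivAt (turningEnergy g s) _ x :=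
    fun x hx => hasDerivAt_turningEnergy hg hs (hO.trans hx)
  refine monotoneOn_of_deriv_nonneg (convex_Ioi _)
    (fun x hx => (hd x hx).continuousAt.continuousWithinAt)
    (fun x hx => (hd x (interior_subset hx)).differentiableAt.differentiableWithinAt)
    fun θ hθ => ?_
  rw [interior_Ioi] at hθ
  rw [(hd θ hθ).deriv]
  have hS := Real.sinh_pos_iff.2 (hO.trans hθ)
  have hC := Real.cosh_pos θ
  have hSC := Real.sinh_lt_cosh θ
  have hc := (radiusGap_neg_iff hg).2 hθ
  have hc' := radiusGapDeriv_neg hg θ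
  set r := radiusGap g θ / radiusGapDeriv g θ with hr
  have hr0 : 0 < r := div_pos_of_neg_of_neg hc hc'
  -- in terms of `t = tanh θ`, the ratio `r = (g t - 1) / (g - t)` is at most `t`
  have hrt : r * Real.cosh θ ≤ Real.sinh θ := by
    rw [hr, div_mul_eq_mul_div, div_le_iff_of_neg hc', radiusGap, radiusGapDeriv]
    nlinarith
  have hr1 : r < 1 := by
    by_contra h
    nlinarith
  have h1 : g ^ 3 * Real.sinh θ / Real.cosh θ ^ 2 * r ≤ g ^ 3 / Real.cosh θ := by
    rw [div_mul_eq_mul_div, div_le_div_iff₀ (by positivity) hC]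
    have : Real.sinh θ * r ≤ Real.cosh θ := by nlinarith
    have hg3 : 0 < g ^ 3 * Real.cosh θ := by positivity
    nlinarith
  have h2 : Real.cosh θ / Real.sinh θ ^ 2 * r ≤ 1 / Real.sinh θ := by
    rw [div_mul_eq_mul_div, div_le_div_iff₀ (by positivity) hS]
    nlinarith
  have h3 := potentialDeriv_pos hg hs (hO.trans hθ)
  have h4 : potentialDeriv g s θ ≤ potentialDeriv g s θ * (2 - r ^ 2) := by
    have : r ^ 2 ≤ 1 := by nlinarith
    nlinarith
  have h5 : 1 / s * (g ^ 3 * Real.sinh θ / Real.cosh θ ^ 2 + Real.cosh θ / Real.sinh θ ^ 2) * r ≤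
      potentialDeriv g s θ := by
    rw [potentialDeriv, mul_assoc]
    gcongr
    linarith
  linarith

include hα

/-- If the slope of the axis energy at `b` is not positive, then `turningEnergy` at `b` does not
exceed the axis energy. -/
theorem turningEnergy_le_axisEnergy {b : ℝ} (hb : thetaOverlap (g ^ 2) < b)
    (hslope : axisSlope α g s b ≤ 0) : turningEnergy g s b ≤ axisEnergy α g s b := by
  have hc := (radiusGap_neg_iff hg).2 hb
  have hc' := radiusGapDeriv_neg hg b
  have hr0 : 0 < radiusGap g b / radiusGapDeriv g b := div_pos_of_neg_of_neg hc hc'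
  rw [axisSlope] at hslope
  rw [turningEnergy, axisEnergy, abs_of_neg hc]
  have h : α * g ^ 2 / s / -radiusGap g b = -(α * g ^ 2 / s * (radiusGapDeriv g b /
      radiusGap g b ^ 2)) * (radiusGap g b / radiusGapDeriv g b) := by
    have h1 := hc.ne
    have h2 := hc'.ne
    field_simp
  rw [h]
  gcongr
  linarith

/-- On a level `E` above `axisEnergy b`, with `b` beyond the overlap and before the critical point
of the axis energy, the cosine of the phase is an increasing function of `θ` on `(0, b]`. -/
theorem levelCosDeriv_pos {b : ℝ} (hb : thetaOverlap (g ^ 2) < b)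
    (hslope : axisSlope α g s b ≤ 0) (hE : axisEnergy α g s b < E) {θ : ℝ} (hθ : 0 < θ)
    (hθb : θ ≤ b) : potential g s θ < E ∧ 0 < levelCosDeriv α g s E θ := by
  have hg0 : 0 < g := by linarith
  have hb0 := (thetaOverlap_sq_pos hg).trans hb
  have hcb := (radiusGap_neg_iff hg).2 hb
  have hc' := radiusGapDeriv_neg hg θ
  have hF' := potentialDeriv_pos hg hs hθ
  have hF : potential g s θ < E := by
    have h1 := (strictMonoOn_potential hg hs).monotoneOn hθ hb0 hθb
    have h2 : 0 < α * g ^ 2 / s / |radiusGap g b| := by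
      have := abs_pos.2 hcb.ne
      positivity
    rw [axisEnergy] at hE
    linarith
  refine ⟨hF, ?_⟩
  have hk : 0 < s / (α * g ^ 2) := by positivity
  suffices h : radiusGapDeriv g θ * (E - potential g s θ) +
      radiusGap g θ * -potentialDeriv g s θ < 0 by
    rw [levelCosDeriv, neg_mul, neg_pos]
    exact mul_neg_of_pos_of_neg hk h
  rcases le_or_gt θ (thetaOverlap (g ^ 2)) with h | h
  · have hc : 0 ≤ radiusGap g θ := by
      rw [← radiusGap_thetaOverlap hg]
      exact (strictAnti_radiusGap hg).antitone h
    nlinarith [mul_pos (neg_pos.2 hc') (sub_pos.2 hF)]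
  · have hm : turningEnergy g s θ < E :=
      (monotoneOn_turningEnergy hg hs h hb hθb).trans_lt
        ((turningEnergy_le_axisEnergy hα hg hs hb hslope).trans_lt hE)
    rw [turningEnergy] at hm
    have h1 : potentialDeriv g s θ * (radiusGap g θ / radiusGapDeriv g θ) <
      E - potential g s θ := by linarith
    have h2 := mul_lt_mul_of_neg_left h1 hc'
    have h3 : radiusGapDeriv g θ * (potentialDeriv g s θ * (radiusGap g θ / radiusGapDeriv g θ)) =
        radiusGap g θ * potentialDeriv g s θ := by
      have := hc'.ne
      field_simp
    linarith

theorem one_lt_levelCos {b : ℝ} (hb : thetaOverlap (g ^ 2) < b) (hE : axisEnergy α g s b < E) :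
    1 < levelCos α g s E b := by
  have hg0 : 0 < g := by linarith
  have hc := (radiusGap_neg_iff hg).2 hb
  rw [axisEnergy, abs_of_neg hc] at hE
  have h1 : α * g ^ 2 / s / -radiusGap g b < E - potential g s b := by linarith
  rw [div_lt_iff₀ (by linarith), div_lt_iff₀ hs] at h1
  have e : levelCos α g s E b =
      (E - potential g s b) * -radiusGap g b * s / (α * g ^ 2) := by rw [levelCos]; ring
  rw [e, one_lt_div (by positivity)]
  exact h1

theorem levelCos_lt_neg_one {a : ℝ} (ha : a < thetaOverlap (g ^ 2))
    (hE : axisEnergy α g s a < E) : levelCos α g s E a < -1 := by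
  have hg0 : 0 < g := by linarith
  have hc := (radiusGap_pos_iff hg).2 ha
  rw [axisEnergy, abs_of_pos hc] at hE
  have h1 : α * g ^ 2 / s / radiusGap g a < E - potential g s a := by linarith
  rw [div_lt_iff₀ hc, div_lt_iff₀ hs] at h1
  have e : levelCos α g s E a =
      -((E - potential g s a) * radiusGap g a * s / (α * g ^ 2)) := by rw [levelCos]; ring
  rw [e, neg_lt_neg_iff, one_lt_div (by positivity)]
  exact h1

/-- A point of the level `E` has a phase. -/
theorem exists_phase_of_hamiltonian_eq {θ₀ W₀ : ℝ} (hmem : (θ₀, W₀) ∈ phaseSpace (g ^ 2))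
    (hE : hamiltonian α (g ^ 2) (s ^ 2) θ₀ W₀ = E) : ∃ χ₀ : ℝ,
      levelCos α g s E θ₀ = Real.cos χ₀ ∧ W₀ = levelRadius α g s E θ₀ * Real.sin χ₀ := by
  have hg0 : 0 < g := by linarith
  have hQ := sqDist_pos hg hs hmem
  rw [hamiltonian_eq hg hs] at hE
  set q := √(sqDist (g ^ 2) (s ^ 2) θ₀ W₀) with hq
  have hq0 : 0 < q := Real.sqrt_pos.2 hQ
  have hq2 : q ^ 2 = (s / g * radiusGap g θ₀) ^ 2 + W₀ ^ 2 := by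
    rw [hq, Real.sq_sqrt hQ.le, sqDist_eq hg]
  have hEF : E - potential g s θ₀ = α * g / q := by linarith
  have hR : levelRadius α g s E θ₀ = q := by
    rw [levelRadius, hEF]; field_simp
  have hv : levelCos α g s E θ₀ = -(s / g * radiusGap g θ₀) / q := by
    rw [levelCos, hEF]; field_simp
  set z : ℂ := ⟨-(s / g * radiusGap g θ₀) / q, W₀ / q⟩ with hz
  have hnorm : ‖z‖ = 1 := by
    rw [Complex.norm_eq_sqrt_sq_add_sq, hz]
    simp only
    rw [div_pow, div_pow, neg_sq, ← add_div, ← hq2, div_self (by positivity), Real.sqrt_one]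
  have h1 := Complex.norm_mul_cos_arg z
  have h2 := Complex.norm_mul_sin_arg z
  rw [hnorm, one_mul] at h1 h2
  refine ⟨z.arg, ?_, ?_⟩
  · rw [h1, hv]
  · rw [h2, hR, hz]
    simp only
    field_simp

/-- The key existence statement: the part of the level `E` in the strip `0 < θ < b` is a closed
curve which is traversed periodically and revolves around the overlap point. In the phase `χ`, the
flow is `χ' = α g v' / R²`, with `v = levelCos` and `R = levelRadius`. -/
theorem leapfrogs_of_axisEnergy_lt {b : ℝ} (hb : thetaOverlap (g ^ 2) < b)
    (hslope : axisSlope α g s b ≤ 0) (hE : axisEnergy α g s b < E) {θ₀ W₀ : ℝ}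
    (hmem : (θ₀, W₀) ∈ phaseSpace (g ^ 2)) (hθ₀ : θ₀ < b)
    (h0E : hamiltonian α (g ^ 2) (s ^ 2) θ₀ W₀ = E) : Leapfrogs α (g ^ 2) (s ^ 2) θ₀ W₀ := by
  have hg0 : 0 < g := by linarith
  have hO := thetaOverlap_sq_pos hg
  have hpos : ∀ θ, 0 < θ → θ ≤ b → potential g s θ < E ∧ 0 < levelCosDeriv α g s E θ :=
    fun θ h1 h2 => levelCosDeriv_pos hα hg hs hb hslope hE h1 h2
  obtain ⟨a, ⟨ha0, ha⟩, haE⟩ : ∃ a ∈ Set.Ioo 0 (min θ₀ (thetaOverlap (g ^ 2))),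
      axisEnergy α g s a < E := by
    obtain ⟨a, h1, h2⟩ := (((tendsto_axisEnergy_zero hs α).eventually_lt_atBot E).and
      (Ioo_mem_nhdsGT (lt_min hmem.1 hO))).exists
    exact ⟨a, h2, h1⟩
  have haθ : a < θ₀ := ha.trans_le (min_le_left _ _)
  have haO : a < thetaOverlap (g ^ 2) := ha.trans_le (min_le_right _ _)
  obtain ⟨Θ, hΘl, hΘ⟩ := exists_inverse_of_strictDeriv_pos (v := levelCos α g s E)
    (v' := levelCosDeriv α g s E) (haO.trans hb)
    (fun x hx => hasStrictDerivAt_levelCos α g s E (ha0.trans_le hx.1))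
    (fun x hx => (hpos x (ha0.trans_le hx.1) hx.2).2)
  have hcos : ∀ χ, Real.cos χ ∈ Set.Ioo (levelCos α g s E a) (levelCos α g s E b) := fun χ =>
    ⟨(levelCos_lt_neg_one hα hg hs haO haE).trans_le (Real.neg_one_le_cos χ),
      (Real.cos_le_one χ).trans_lt (one_lt_levelCos hα hg hs hb hE)⟩
  -- the angle coordinate as a function of the phase
  set Z : ℝ → ℝ := fun χ => Θ (Real.cos χ) with hZ
  have hZ0 : ∀ χ, 0 < Z χ := fun χ => ha0.trans (hΘ _ (hcos χ)).1.1
  have hZb : ∀ χ, Z χ ≤ b := fun χ => (hΘ _ (hcos χ)).1.2.le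
  have hZv : ∀ χ, levelCos α g s E (Z χ) = Real.cos χ := fun χ => (hΘ _ (hcos χ)).2.1
  have hZd : ∀ χ, HasDerivAt Z ((levelCosDeriv α g s E (Z χ))⁻¹ * -Real.sin χ) χ := fun χ =>
    (hΘ _ (hcos χ)).2.2.comp χ (Real.hasDerivAt_cos χ)
  have hZc : Continuous Z := continuous_iff_continuousAt.2 fun χ => (hZd χ).continuousAt
  have hZper : Function.Periodic Z (2 * Real.pi) := fun χ => by
    simp only [hZ, Real.cos_add_two_pi]
  have hFE : ∀ χ, 0 < E - potential g s (Z χ) := fun χ =>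
    sub_pos.2 (hpos _ (hZ0 χ) (hZb χ)).1
  have hv' : ∀ χ, 0 < levelCosDeriv α g s E (Z χ) := fun χ => (hpos _ (hZ0 χ) (hZb χ)).2
  set ω : ℝ → ℝ := fun χ =>
    levelCosDeriv α g s E (Z χ) * (E - potential g s (Z χ)) ^ 2 / (α * g) with hω
  have hωc : Continuous ω := by
    refine continuous_iff_continuousAt.2 fun χ => ?_
    have h1 : ContinuousAt (fun χ => levelCosDeriv α g s E (Z χ)) χ :=
      ContinuousAt.comp (g := levelCosDeriv α g s E) (continuousAt_levelCosDeriv α g s E (hZ0 χ))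
        hZc.continuousAt
    have h2 : ContinuousAt (fun χ => potential g s (Z χ)) χ :=
      ContinuousAt.comp (g := potential g s)
        (hasStrictDerivAt_potential g s (hZ0 χ)).hasDerivAt.continuousAt hZc.continuousAt
    exact (h1.mul ((continuousAt_const.sub h2).pow 2)).div_const _
  have hωpos : ∀ χ, 0 < ω χ := fun χ => by
    have h1 := hv' χ
    have h2 := hFE χ
    simp only [hω]
    positivity
  have hωper : Function.Periodic ω (2 * Real.pi) := fun χ => by
    simp only [hω, hZper χ]
  obtain ⟨χ₀, hχcos, hχsin⟩ := exists_phase_of_hamiltonian_eq hα hg hs hmem h0E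
  obtain ⟨χ, T, hT, hχ0, hχd, hχT⟩ :=
    exists_phase hωc hωpos Real.two_pi_pos hωper χ₀
  have hZχ₀ : Z χ₀ = θ₀ := by
    simp only [hZ]
    rw [← hχcos, hΘl θ₀ ⟨haθ.le, hθ₀.le⟩]
  have hχc : Continuous χ := continuous_iff_continuousAt.2 fun t => (hχd t).continuousAt
  set R : ℝ → ℝ := fun χ => levelRadius α g s E (Z χ) with hR
  have hRpos : ∀ χ, 0 < R χ := fun χ => by
    have := hFE χ
    simp only [hR, levelRadius]
    positivity
  -- in the phase, the gap is `-R cos χ` up to the factor `s / g`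
  have hgap : ∀ χ, R χ * Real.cos χ = -(s / g * radiusGap g (Z χ)) := fun χ => by
    have := (hFE χ).ne'
    simp only [hR]
    rw [← hZv χ, levelRadius, levelCos]
    field_simp
  have hdist : ∀ χ, √(sqDist (g ^ 2) (s ^ 2) (Z χ) (R χ * Real.sin χ)) = R χ := fun χ => by
    have h : (R χ * Real.cos χ) ^ 2 + (R χ * Real.sin χ) ^ 2 = R χ ^ 2 := by
      linear_combination (R χ ^ 2) * Real.sin_sq_add_cos_sq χ
    rw [sqDist_eq hg, ← neg_sq (s / g * _), ← hgap χ, h, Real.sqrt_sq (hRpos χ).le]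
  have hθd : ∀ t, HasDerivAt (fun t => Z (χ t)) (-(Real.sin (χ t) *
      (E - potential g s (Z (χ t))) ^ 2 / (α * g))) t := fun t => by
    refine (HasDerivAt.comp t (hZd (χ t)) (hχd t)).congr_deriv ?_
    simp only [hω]
    have := (hv' (χ t)).ne'
    field_simp
  refine ⟨fun t => Z (χ t), fun t => R (χ t) * Real.sin (χ t), ⟨fun t => ⟨hZ0 _, fun h => ?_⟩,
    fun t => ?_, fun t => ?_⟩, ?_, ?_, T, hT, fun t => ?_, fun t => ?_, ?_⟩
  · obtain ⟨h1, h2⟩ := Prod.ext_iff.1 h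
    simp only at h1 h2
    have h3 := hgap (χ t)
    rw [h1, radiusGap_thetaOverlap hg, mul_zero, neg_zero] at h3
    have h4 := Real.sin_sq_add_cos_sq (χ t)
    have h5 := (hRpos (χ t)).ne'
    rw [(mul_eq_zero_iff_left h5).1 h2, (mul_eq_zero_iff_left h5).1 h3] at h4
    norm_num at h4
  · refine (hθd t).congr_deriv ?_
    rw [fieldTheta_eq hg, hdist]
    have := (hFE (χ t)).ne'
    simp only [hR, levelRadius]
    field_simp
  · have hFd : HasDerivAt (fun t => potential g s (Z (χ t))) (potentialDeriv g s (Z (χ t)) *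
        (-(Real.sin (χ t) * (E - potential g s (Z (χ t))) ^ 2 / (α * g)))) t :=
      HasDerivAt.comp t (h₂ := potential g s)
        (hasStrictDerivAt_potential g s (hZ0 (χ t))).hasDerivAt (hθd t)
    have hRd := ((hFd.const_sub E).fun_inv (hFE (χ t)).ne').const_mul (α * g)
    have hsd := (Real.hasDerivAt_sin (χ t)).comp t (hχd t)
    have h := hRd.mul hsd
    refine (h.congr_deriv ?_).congr_of_eventuallyEq (Filter.Eventually.of_forall fun u => ?_)
    · rw [fieldW_eq hg hs, hdist]
      simp only [hω, Function.comp_apply, hR, levelRadius]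
      have hne := (hFE (χ t)).ne'
      have hc := hZv (χ t)
      rw [levelCos] at hc
      have hsc := Real.sin_sq (χ t)
      rw [levelCosDeriv]
      generalize E - potential g s (Z (χ t)) = e at *
      generalize radiusGap g (Z (χ t)) = c at *
      generalize radiusGapDeriv g (Z (χ t)) = c' at *
      generalize potentialDeriv g s (Z (χ t)) = F' at *
      have h1 : α * g * (-(-(F' * -(Real.sin (χ t) * e ^ 2 / (α * g)))) / e ^ 2) *
          Real.sin (χ t) = -F' * Real.sin (χ t) ^ 2 := by
        field_simp
      have h2 : α * g * e⁻¹ * (Real.cos (χ t) * (-(s / (α * g ^ 2)) * (c' * e + c * -F') *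
          e ^ 2 / (α * g))) = -F' * Real.cos (χ t) ^ 2 -
            s / (α * g ^ 2) * c' * e ^ 2 * Real.cos (χ t) := by
        have : α * g * e⁻¹ * (Real.cos (χ t) * (-(s / (α * g ^ 2)) * (c' * e + c * -F') *
          e ^ 2 / (α * g))) = -F' * Real.cos (χ t) * (-(s / (α * g ^ 2)) * (c * e)) -
            s / (α * g ^ 2) * c' * e ^ 2 * Real.cos (χ t) := by
          field_simp
          ring
        rw [this, hc]
        ring
      rw [h1, h2, hsc, ← hc]
      field_simp
      ring
    · simp only [hR, levelRadius, Pi.mul_apply, Function.comp_apply]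
      ring
  · simp only [hχ0, hZχ₀]
  · simp only [hχ0, hR, hZχ₀]
    exact hχsin.symm
  · simp only [hχT, hZper _]
  · simp only [hχT, hR, hZper _, Real.sin_add_two_pi]
  · -- the quotient of the gap by `θ - θ_γ` extends continuously to the overlap
    set D : ℝ → ℝ := fun θ => -(s / g * dslope (radiusGap g) (thetaOverlap (g ^ 2)) θ) with hD
    have hslope' : ∀ θ, dslope (radiusGap g) (thetaOverlap (g ^ 2)) θ < 0 := fun θ => by
      by_cases h : θ = thetaOverlap (g ^ 2)
      · rw [h, dslope_same, (hasStrictDerivAt_radiusGap g _).hasDerivAt.deriv]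
        exact radiusGapDeriv_neg hg _
      · rw [dslope_of_ne _ h, slope_def_field, div_neg_iff]
        rcases lt_or_gt_of_ne h with h | h
        · exact Or.inl ⟨sub_pos.2 (strictAnti_radiusGap hg h), sub_neg.2 h⟩
        · exact Or.inr ⟨sub_neg.2 (strictAnti_radiusGap hg h), sub_pos.2 h⟩
    have hDpos : ∀ θ, 0 < D θ := fun θ => by
      have h1 : 0 < s / g := by positivity
      have h2 := mul_neg_of_pos_of_neg h1 (hslope' θ)
      simp only [hD]
      linarith
    have hDc : Continuous D := by
      have : Continuous (dslope (radiusGap g) (thetaOverlap (g ^ 2))) := by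
        rw [← continuousOn_univ, continuousOn_dslope Filter.univ_mem]
        exact ⟨(continuous_radiusGap g).continuousOn,
          (hasStrictDerivAt_radiusGap g _).hasDerivAt.differentiableAt⟩
      exact (this.const_mul _).neg
    have hDeq : ∀ θ, D θ * (θ - thetaOverlap (g ^ 2)) = -(s / g * radiusGap g θ) := fun θ => by
      have := sub_smul_dslope (radiusGap g) (thetaOverlap (g ^ 2)) θ
      rw [radiusGap_thetaOverlap hg, sub_zero, smul_eq_mul] at this
      rw [← this]
      simp only [hD]
      ring
    refine revolvesAround_of_stretched_angle (χ := χ) (R := fun t => R (χ t))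
      (k := fun t => (D (Z (χ t)))⁻¹) hχc ((hDc.comp (hZc.comp hχc)).inv₀ fun t => (hDpos _).ne')
      (fun t => inv_pos.2 (hDpos _)) (fun t => hRpos _) (fun t => ?_) (fun t => ?_) ?_ ?_
    · have h1 := hDeq (Z (χ t))
      rw [← hgap (χ t)] at h1
      have h2 := (hDpos (Z (χ t))).ne'
      field_simp
      linarith
    · simp
    · have := hχT 0
      rw [zero_add] at this
      simp only [this, hZper _]
    · have := hχT 0
      rwa [zero_add] at this

end

/-! ### Leapfrogging solutions -/

section
variable {α g s : ℝ} (hα : 0 < α) (hg : 1 < g) (hs : 0 < s)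

/-- Solutions conserve the Hamiltonian. -/
theorem hamiltonian_eq_of_isSolution (hg : 1 < g) (hs : 0 < s) {θ W : ℝ → ℝ}
    (h : IsSolution α (g ^ 2) (s ^ 2) θ W) (t u : ℝ) :
    hamiltonian α (g ^ 2) (s ^ 2) (θ t) (W t) = hamiltonian α (g ^ 2) (s ^ 2) (θ u) (W u) := by
  have hd : ∀ t, HasDerivAt (fun t => hamiltonian α (g ^ 2) (s ^ 2) (θ t) (W t)) 0 t := fun t => by
    have hQ := sqDist_pos hg hs (h.mem t)
    have hq := Real.sqrt_pos.2 hQ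
    have hθ := h.deriv_theta t
    have hW := h.deriv_W t
    rw [fieldTheta_eq hg] at hθ
    rw [fieldW_eq hg hs] at hW
    have hF := HasDerivAt.comp t (h₂ := potential g s)
      (hasStrictDerivAt_potential g s (h.mem t).1).hasDerivAt hθ
    have hc := HasDerivAt.comp t (h₂ := radiusGap g)
      (hasStrictDerivAt_radiusGap g (θ t)).hasDerivAt hθ
    have hQd := ((hc.const_mul (s / g)).pow 2).add (hW.pow 2)
    have hQe : ∀ u, ((fun y => s / g * (radiusGap g ∘ θ) y) ^ 2 + W ^ 2) u =
        sqDist (g ^ 2) (s ^ 2) (θ u) (W u) := fun u => by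
      rw [sqDist_eq hg]; rfl
    have hqd := (hQd.sqrt (by rw [hQe]; exact hQ.ne')).fun_inv (by rw [hQe]; exact hq.ne')
    refine ((hF.add (hqd.const_mul (α * g))).congr_deriv ?_).congr_of_eventuallyEq
      (Filter.Eventually.of_forall fun u => ?_)
    · rw [hQe]
      have hg0 : g ≠ 0 := by linarith
      have hq0 := hq.ne'
      simp only [Function.comp_apply, Nat.cast_ofNat, Nat.add_one_sub_one, pow_one]
      generalize √(sqDist (g ^ 2) (s ^ 2) (θ t) (W t)) = q at *
      field_simp
      ring
    · beta_reduce
      rw [hamiltonian_eq hg hs, ← hQe, div_eq_mul_inv]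
      rfl
  exact is_const_of_deriv_eq_zero (fun t => (hd t).differentiableAt) (fun t => (hd t).deriv) t u

/-- The vector field is continuously differentiable in the phase space. -/
theorem contDiffAt_field (hg : 1 < g) (hs : 0 < s) {p : ℝ × ℝ} (hp : p ∈ phaseSpace (g ^ 2)) :
    ContDiffAt ℝ 1 (fun p : ℝ × ℝ => (fieldTheta α (g ^ 2) (s ^ 2) p.1 p.2,
      fieldW α (g ^ 2) (s ^ 2) p.1 p.2)) p := by
  have hQ : 0 < sqDist (g ^ 2) (s ^ 2) p.1 p.2 := sqDist_pos hg hs hp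
  have hS : Real.sinh p.1 ≠ 0 := (Real.sinh_pos_iff.2 hp.1).ne'
  have hC : Real.cosh p.1 ≠ 0 := (Real.cosh_pos p.1).ne'
  have hg0 : √(g ^ 2) ≠ 0 := by
    rw [Real.sqrt_sq (by linarith)]; linarith
  have hsinh : ContDiffAt ℝ 1 (fun p : ℝ × ℝ => Real.sinh p.1) p := contDiffAt_fst.sinh
  have hcosh : ContDiffAt ℝ 1 (fun p : ℝ × ℝ => Real.cosh p.1) p := contDiffAt_fst.cosh
  have hQd : ContDiffAt ℝ 1 (fun p : ℝ × ℝ => sqDist (g ^ 2) (s ^ 2) p.1 p.2 ^ (3 / 2 : ℝ)) p := by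
    refine ContDiffAt.rpow_const_of_ne ?_ hQ.ne'
    unfold sqDist
    exact (contDiffAt_const.mul ((hcosh.sub (contDiffAt_const.mul hsinh)).pow 2)).add
      (contDiffAt_snd.pow 2)
  have hQ' : sqDist (g ^ 2) (s ^ 2) p.1 p.2 ^ (3 / 2 : ℝ) ≠ 0 := (Real.rpow_pos_of_pos hQ _).ne'
  refine ContDiffAt.prodMk ?_ ?_
  · unfold fieldTheta
    exact ((contDiffAt_const.mul contDiffAt_snd).div hQd hQ').neg
  · unfold fieldW
    refine (contDiffAt_const.mul ((contDiffAt_const.div hcosh hC).add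
      (contDiffAt_const.div hsinh hS))).add (ContDiffAt.div ?_ (contDiffAt_const.mul hQd)
        (mul_ne_zero hg0 hQ'))
    exact (contDiffAt_const.mul (hsinh.sub (contDiffAt_const.mul hcosh))).mul
      (hcosh.sub (contDiffAt_const.mul hsinh))

/-- A solution which passes through an equilibrium is constant. -/
theorem eq_of_isEquilibrium (hg : 1 < g) (hs : 0 < s) {θ W : ℝ → ℝ}
    (h : IsSolution α (g ^ 2) (s ^ 2) θ W) {p : ℝ × ℝ} (hp : IsEquilibrium α (g ^ 2) (s ^ 2) p)
    {t₀ : ℝ} (h0 : (θ t₀, W t₀) = p) (t : ℝ) : (θ t, W t) = p := by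
  set f : ℝ → ℝ × ℝ := fun t => (θ t, W t) with hf
  set v : ℝ × ℝ → ℝ × ℝ := fun p => (fieldTheta α (g ^ 2) (s ^ 2) p.1 p.2,
    fieldW α (g ^ 2) (s ^ 2) p.1 p.2) with hv
  have hfd : ∀ t, HasDerivAt f (v (f t)) t := fun t => (h.deriv_theta t).prodMk (h.deriv_W t)
  have hvp : v p = 0 := Prod.ext hp.2.1 hp.2.2
  have hfc : Continuous f := continuous_iff_continuousAt.2 fun t => (hfd t).continuousAt
  obtain ⟨K, U, hU, hL⟩ := (contDiffAt_field (α := α) hg hs hp.1).exists_lipschitzOnWith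
  have hopen : IsOpen {t | f t = p} := by
    rw [isOpen_iff_mem_nhds]
    intro u hu
    have hmem : ∀ᶠ t in nhds u, f t ∈ U := hfc.continuousAt.eventually (by
      rw [show f u = p from hu]; exact hU)
    exact ODE_solution_unique_of_eventually (v := fun _ => v) (s := fun _ => U) (f := f)
      (g := fun _ => p) (Filter.Eventually.of_forall fun _ => hL)
      (hmem.mono fun t ht => ⟨hfd t, ht⟩)
      (Filter.Eventually.of_forall fun t => ⟨by rw [hvp]; exact hasDerivAt_const t p,
        mem_of_mem_nhds hU⟩) hu
  have hclosed : IsClosed {t | f t = p} := isClosed_eq hfc continuous_const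
  have huniv := IsClopen.eq_univ ⟨hclosed, hopen⟩ ⟨t₀, h0⟩
  exact huniv.ge (Set.mem_univ t)

include hg

/-- Without equilibria the axis energy beyond the overlap stays above its limit. -/
theorem limit_lt_axisEnergy
    (hslope : ∀ θ, thetaOverlap (g ^ 2) < θ → axisSlope α g s θ < 0) {θ : ℝ}
    (hθ : thetaOverlap (g ^ 2) < θ) : Real.pi * g ^ 3 / (2 * s) < axisEnergy α g s θ := by
  have hanti : StrictAntiOn (axisEnergy α g s) (Set.Ioi (thetaOverlap (g ^ 2))) := by
    refine strictAntiOn_of_deriv_neg (convex_Ioi _) (continuousOn_axisEnergy_of_gt hg α s)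
      fun x hx => ?_
    rw [interior_Ioi] at hx
    rw [(hasDerivAt_axisEnergy_of_gt hg α s hx).deriv]
    exact hslope x hx
  have h1 : thetaOverlap (g ^ 2) < θ + 1 := by linarith
  refine lt_of_le_of_lt (le_of_tendsto (tendsto_axisEnergy_atTop hg α s) ?_)
    (hanti hθ h1 (by linarith))
  filter_upwards [Filter.eventually_ge_atTop (θ + 1)] with x hx
  exact hanti.antitoneOn h1 (h1.trans_le hx) hx

include hs

/-- The axis energy beyond the overlap has a strict minimum at a critical point. -/
theorem axisEnergy_lt_of_criticalRatio_eq {θs : ℝ} (hθs : thetaOverlap (g ^ 2) < θs)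
    (hcrit : criticalRatio g (Real.tanh θs) = α * g ^ 2) {θ : ℝ}
    (hθ : thetaOverlap (g ^ 2) < θ) (hne : θ ≠ θs) :
    axisEnergy α g s θs < axisEnergy α g s θ := by
  have hcont := continuousOn_axisEnergy_of_gt hg α s
  have hratio : ∀ x y, thetaOverlap (g ^ 2) < x → x < y →
      criticalRatio g (Real.tanh x) < criticalRatio g (Real.tanh y) := fun x y hx hxy =>
    strictMonoOn_criticalRatio hg
      (Set.Ioo_subset_Icc_self (tanh_mem_of_thetaOverlap_lt hg hx))
      (Set.Ioo_subset_Icc_self (tanh_mem_of_thetaOverlap_lt hg (hx.trans hxy)))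
      (strictMono_tanh hxy)
  rcases lt_or_gt_of_ne hne with h | h
  · have hsub : Set.Icc θ θs ⊆ Set.Ioi (thetaOverlap (g ^ 2)) := fun x hx => hθ.trans_le hx.1
    refine strictAntiOn_of_deriv_neg (convex_Icc θ θs) (hcont.mono hsub) (fun x hx => ?_)
      (Set.left_mem_Icc.2 h.le) (Set.right_mem_Icc.2 h.le) h
    have hx' := hsub (interior_subset hx)
    rw [interior_Icc] at hx
    rw [(hasDerivAt_axisEnergy_of_gt hg α s hx').deriv, axisSlope_neg_iff hg hs α hx', ← hcrit]
    exact hratio x θs hx' hx.2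
  · have hsub : Set.Icc θs θ ⊆ Set.Ioi (thetaOverlap (g ^ 2)) := fun x hx => hθs.trans_le hx.1
    refine strictMonoOn_of_deriv_pos (convex_Icc θs θ) (hcont.mono hsub) (fun x hx => ?_)
      (Set.left_mem_Icc.2 h.le) (Set.right_mem_Icc.2 h.le) h
    have hx' := hsub (interior_subset hx)
    rw [interior_Icc] at hx
    rw [(hasDerivAt_axisEnergy_of_gt hg α s hx').deriv, axisSlope_pos_iff hg hs α hx', ← hcrit]
    exact hratio θs x hθs hx.1

omit hg hs in
/-- A leapfrogging solution meets every ray issuing from the overlap point. -/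
theorem exists_mem_ray_of_isLeapfrogging {γ : ℝ} {θ W : ℝ → ℝ} (h : IsLeapfrogging γ θ W)
    (β : ℝ) : ∃ t r : ℝ, 0 < r ∧ θ t = thetaOverlap γ + r * Real.cos β ∧
      W t = r * Real.sin β := by
  obtain ⟨T, -, hθ, hW, hrev⟩ := h
  obtain ⟨t, r, hr, h1, h2⟩ := exists_mem_ray_of_revolvesAround
    (by simpa using hθ 0) (by simpa using hW 0) hrev β
  exact ⟨t, r, hr, h1, by rw [h2, zero_add]⟩

/-- The energy of a leapfrogging solution is the axis energy at a point beyond the overlap. -/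
theorem exists_axisEnergy_of_isLeapfrogging {θ W : ℝ → ℝ}
    (h : IsSolution α (g ^ 2) (s ^ 2) θ W) (hl : IsLeapfrogging (g ^ 2) θ W) :
    ∃ t, thetaOverlap (g ^ 2) < θ t ∧ W t = 0 ∧
      hamiltonian α (g ^ 2) (s ^ 2) (θ 0) (W 0) = axisEnergy α g s (θ t) := by
  obtain ⟨t, r, hr, h1, h2⟩ := exists_mem_ray_of_isLeapfrogging hl 0
  rw [Real.cos_zero, mul_one] at h1
  rw [Real.sin_zero, mul_zero] at h2
  refine ⟨t, by linarith, h2, ?_⟩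
  rw [hamiltonian_eq_of_isSolution hg hs h 0 t, h2, hamiltonian_axis hg hs]

include hα

/-- The regime without equilibria. -/
theorem subcritical (hsub : criticalRatio g 1 ≤ α * g ^ 2) :
    (¬ ∃ p : ℝ × ℝ, IsEquilibrium α (g ^ 2) (s ^ 2) p) ∧
      ∀ θ₀ W₀ : ℝ, (θ₀, W₀) ∈ phaseSpace (g ^ 2) → (Leapfrogs α (g ^ 2) (s ^ 2) θ₀ W₀ ↔
        Real.pi * g ^ 3 / (2 * s) < hamiltonian α (g ^ 2) (s ^ 2) θ₀ W₀) := by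
  have hratio : ∀ θ, thetaOverlap (g ^ 2) < θ → criticalRatio g (Real.tanh θ) < α * g ^ 2 :=
    fun θ hθ => by
      have ht := tanh_mem_of_thetaOverlap_lt hg hθ
      exact (strictMonoOn_criticalRatio hg (Set.Ioo_subset_Icc_self ht)
        (Set.right_mem_Icc.2 (ht.1.trans ht.2).le) ht.2).trans_le hsub
  have hslope : ∀ θ, thetaOverlap (g ^ 2) < θ → axisSlope α g s θ < 0 := fun θ hθ =>
    (axisSlope_neg_iff hg hs α hθ).2 (hratio θ hθ)
  refine ⟨?_, fun θ₀ W₀ hmem => ⟨?_, fun hE => ?_⟩⟩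
  · rintro ⟨p, hp⟩
    obtain ⟨-, h1, h2⟩ := (isEquilibrium_iff hα hg hs p).1 hp
    exact (hratio _ h1).ne h2
  · rintro ⟨θ, W, hsol, rfl, rfl, hl⟩
    obtain ⟨t, ht, -, hE⟩ := exists_axisEnergy_of_isLeapfrogging hg hs hsol hl
    rw [hE]
    exact limit_lt_axisEnergy hg hslope ht
  · obtain ⟨b, hb1, hb2⟩ := (((tendsto_axisEnergy_atTop hg α s).eventually_lt_const hE).and
      (Filter.eventually_gt_atTop (max (thetaOverlap (g ^ 2)) θ₀))).exists
    have hb := (le_max_left _ _).trans_lt hb2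
    exact leapfrogs_of_axisEnergy_lt hα hg hs hb (hslope b hb).le hb1 hmem
      ((le_max_right _ _).trans_lt hb2) rfl

/-- The regime with an equilibrium, which is the saddle bounding the leapfrogging region. -/
theorem supercritical (hsup : α * g ^ 2 < criticalRatio g 1) :
    ∃ θs : ℝ, thetaOverlap (g ^ 2) < θs ∧
      (∀ p : ℝ × ℝ, IsEquilibrium α (g ^ 2) (s ^ 2) p ↔ p = (θs, 0)) ∧
      ∃ θbar : ℝ,
        (∀ θ : ℝ, (0 < θ ∧ θ < thetaOverlap (g ^ 2) ∧
          hamiltonian α (g ^ 2) (s ^ 2) θ 0 = hamiltonian α (g ^ 2) (s ^ 2) θs 0) ↔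
            θ = θbar) ∧
        ∀ θ₀ W₀ : ℝ, (θ₀, W₀) ∈ phaseSpace (g ^ 2) →
          (Leapfrogs α (g ^ 2) (s ^ 2) θ₀ W₀ ↔ (θbar < θ₀ ∧ θ₀ < θs) ∧
            hamiltonian α (g ^ 2) (s ^ 2) θs 0 < hamiltonian α (g ^ 2) (s ^ 2) θ₀ W₀) := by
  have hg0 : 0 < g := by linarith
  have hg1 : 1 / g < 1 := by rw [div_lt_one hg0]; exact hg
  have hzero : criticalRatio g (1 / g) = 0 := by
    have : g * (1 / g) - 1 = 0 := by field_simp; ring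
    rw [criticalRatio, this]
    simp
  obtain ⟨ts, hts, hcrit⟩ := intermediate_value_Ioo hg1.le (continuousOn_criticalRatio hg)
    (show α * g ^ 2 ∈ Set.Ioo _ _ from ⟨by rw [hzero]; positivity, hsup⟩)
  have hts0 : 0 < ts := lt_trans (by positivity) hts.1
  have htanh : Real.tanh (Real.artanh ts) = ts := Real.tanh_artanh ⟨by linarith, hts.2⟩
  set θs := Real.artanh ts
  have hθs : thetaOverlap (g ^ 2) < θs := by
    rw [thetaOverlap, Real.sqrt_sq hg0.le]
    refine Real.artanh_lt_artanh ?_ hts.2 hts.1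
    have : 0 < 1 / g := by positivity
    linarith
  rw [← htanh] at hcrit
  have hO := thetaOverlap_sq_pos hg
  have hequi : ∀ p : ℝ × ℝ, IsEquilibrium α (g ^ 2) (s ^ 2) p ↔ p = (θs, 0) := fun p => by
    rw [isEquilibrium_iff hα hg hs]
    refine ⟨fun ⟨h1, h2, h3⟩ => Prod.ext ?_ h1, ?_⟩
    · exact Real.tanh_injective ((strictMonoOn_criticalRatio hg).injOn
        (Set.Ioo_subset_Icc_self (tanh_mem_of_thetaOverlap_lt hg h2))
        (Set.Ioo_subset_Icc_self (tanh_mem_of_thetaOverlap_lt hg hθs)) (h3.trans hcrit.symm))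
    · rintro rfl
      exact ⟨rfl, hθs, hcrit⟩
  obtain ⟨θbar, hbar, hbarE⟩ := exists_axisEnergy_eq hα hg hs (axisEnergy α g s θs)
  refine ⟨θs, hθs, hequi, θbar, fun θ => ?_, fun θ₀ W₀ hmem => ⟨?_, ?_⟩⟩
  · rw [hamiltonian_axis hg hs, hamiltonian_axis hg hs]
    refine ⟨fun ⟨h1, h2, h3⟩ => (strictMonoOn_axisEnergy hα hg hs).injOn ⟨h1, h2⟩ hbar
      (h3.trans hbarE.symm), ?_⟩
    rintro rfl
    exact ⟨hbar.1, hbar.2, hbarE⟩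
  · rintro ⟨θ, W, hsol, rfl, rfl, hl⟩
    rw [hamiltonian_axis hg hs]
    have hE : axisEnergy α g s θs < hamiltonian α (g ^ 2) (s ^ 2) (θ 0) (W 0) := by
      obtain ⟨t, ht, htW, htE⟩ := exists_axisEnergy_of_isLeapfrogging hg hs hsol hl
      rw [htE]
      refine axisEnergy_lt_of_criticalRatio_eq hg hs hθs hcrit ht fun heq => ?_
      -- otherwise the solution would rest at the equilibrium, and miss the ray of angle `π`
      obtain ⟨u, r, hr, hu, -⟩ := exists_mem_ray_of_isLeapfrogging hl Real.pi
      have hconst := eq_of_isEquilibrium hg hs hsol ((hequi (θs, 0)).2 rfl)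
        (t₀ := t) (by rw [heq, htW]) u
      have := (Prod.ext_iff.1 hconst).1
      simp only at this
      rw [this, Real.cos_pi] at hu
      linarith
    refine ⟨?_, hE⟩
    -- the energy keeps the curve away from the two vertical lines, and it meets the overlap line
    have havoid : ∀ x, radiusGap g x ≠ 0 → axisEnergy α g s x = axisEnergy α g s θs →
        ∀ t, θ t ≠ x := fun x hx hxE t htx => by
      have h1 := hamiltonian_le_axisEnergy hα hg hs hx (W t)
      rw [hxE, ← htx, hamiltonian_eq_of_isSolution hg hs hsol t 0] at h1
      linarith
    have havoid_s := havoid θs ((radiusGap_neg_iff hg).2 hθs).ne rfl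
    have havoid_bar := havoid θbar ((radiusGap_pos_iff hg).2 hbar.2).ne' hbarE
    obtain ⟨u, r, hr, hu, -⟩ := exists_mem_ray_of_isLeapfrogging hl (Real.pi / 2)
    rw [Real.cos_pi_div_two, mul_zero, add_zero] at hu
    have hcont : Continuous θ :=
      continuous_iff_continuousAt.2 fun t => (hsol.deriv_theta t).continuousAt
    constructor
    · by_contra! h
      obtain ⟨t, ht⟩ := mem_range_of_exists_le_of_exists_ge hcont ⟨0, h⟩
        ⟨u, by rw [hu]; exact hbar.2.le⟩
      exact havoid_bar t ht
    · by_contra! h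
      obtain ⟨t, ht⟩ := mem_range_of_exists_le_of_exists_ge hcont
        ⟨u, by rw [hu]; exact hθs.le⟩ ⟨0, h⟩
      exact havoid_s t ht
  · rintro ⟨⟨-, h2⟩, hE⟩
    rw [hamiltonian_axis hg hs] at hE
    refine leapfrogs_of_axisEnergy_lt hα hg hs hθs (le_of_eq ?_) hE hmem h2 rfl
    rw [axisSlope_eq hg α s hθs, hcrit, sub_self, mul_zero]

end

end OppositeFilaments

theorem theorem4 (α : ℝ) (hα : 0 < α) (hα' : α < 1 / 3) :
    ∃ γs : ℝ, 1 < γs ∧ ∀ d : ℝ, 0 < d →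
      (∀ γ : ℝ, 1 < γ → γ ≤ γs →
        (¬ ∃ p : ℝ × ℝ, OppositeFilaments.IsEquilibrium α γ d p) ∧
        ∀ θ₀ W₀ : ℝ, (θ₀, W₀) ∈ OppositeFilaments.phaseSpace γ →
          (OppositeFilaments.Leapfrogs α γ d θ₀ W₀ ↔
            Real.pi * γ ^ (3 / 2 : ℝ) / (2 * √d) <
              OppositeFilaments.hamiltonian α γ d θ₀ W₀)) ∧
      (∀ γ : ℝ, γs < γ →
        ∃ θs : ℝ, OppositeFilaments.thetaOverlap γ < θs ∧
          (∀ p : ℝ × ℝ, OppositeFilaments.IsEquilibrium α γ d p ↔ p = (θs, 0)) ∧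
          ∃ θbar : ℝ,
            (∀ θ : ℝ, (0 < θ ∧ θ < OppositeFilaments.thetaOverlap γ ∧
                OppositeFilaments.hamiltonian α γ d θ 0 =
                  OppositeFilaments.hamiltonian α γ d θs 0) ↔ θ = θbar) ∧
            ∀ θ₀ W₀ : ℝ, (θ₀, W₀) ∈ OppositeFilaments.phaseSpace γ →
              (OppositeFilaments.Leapfrogs α γ d θ₀ W₀ ↔
                (θbar < θ₀ ∧ θ₀ < θs) ∧
                  OppositeFilaments.hamiltonian α γ d θs 0 <
                    OppositeFilaments.hamiltonian α γ d θ₀ W₀)) := by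
  obtain ⟨gs, hgs, hgsα⟩ := OppositeFilaments.exists_threshold hα
  refine ⟨gs ^ 2, by nlinarith, fun d hd => ?_⟩
  obtain ⟨s, hs, rfl⟩ : ∃ s : ℝ, 0 < s ∧ s ^ 2 = d :=
    ⟨√d, Real.sqrt_pos.2 hd, Real.sq_sqrt hd.le⟩
  have hroot : ∀ γ : ℝ, 1 < γ → ∃ g : ℝ, 1 < g ∧ g ^ 2 = γ := fun γ hγ =>
    ⟨√γ, by rw [Real.lt_sqrt (by norm_num)]; linarith, Real.sq_sqrt (by linarith)⟩
  refine ⟨fun γ hγ hle => ?_, fun γ hlt => ?_⟩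
  · obtain ⟨g, hg, rfl⟩ := hroot γ hγ
    have hgg : g ≤ gs := (pow_le_pow_iff_left₀ (by linarith) (by linarith) two_ne_zero).1 hle
    have hratio : OppositeFilaments.criticalRatio g 1 ≤ α * g ^ 2 := by
      rw [OppositeFilaments.criticalRatio_one hg, ← div_le_iff₀ (by positivity), ← hgsα]
      rcases hgg.eq_or_lt with h | h
      · rw [h]
      · exact (OppositeFilaments.threshold_mono hg h).le
    rw [Real.sqrt_sq hs.le, OppositeFilaments.rpow_three_halves_sq (by linarith)]
    exact OppositeFilaments.subcritical hα hg hs hratio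
  · obtain ⟨g, hg, rfl⟩ := hroot γ (by nlinarith)
    have hgg : gs < g := (pow_lt_pow_iff_left₀ (by linarith) (by linarith) two_ne_zero).1 hlt
    refine OppositeFilaments.supercritical hα hg hs ?_
    rw [OppositeFilaments.criticalRatio_one hg, ← lt_div_iff₀ (by positivity), ← hgsα]
    exact OppositeFilaments.threshold_mono hgs hgg
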